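/- Let $\mathcal{X}=P(x,y)\,\partial_x+Q(x,y)\,\partial_y$ be a real analytic vector field on an open neighborhood of the origin of $\mathbb{R}^2$ which has a center at the origin: the origin is a singular point and all nearby trajectories are closed orbits surrounding it. Let $p,q\ge 1$ be coprime integers, and write $\mathcal{X}$ in the weighted polar coordinates $x=\rho^p\cos\varphi$, $y=\rho^q\sin\varphi$: $$\dot\varphi=\frac{A(\varphi,\rho)}{\rho^{p+q}\,(p\cos^2\varphi+q\sin^2\varphi)},\qquad \dot\rho=\frac{\rho\,B(\varphi,\rho)}{\rho^{p+q}\,(p\cos^2\varphi+q\sin^2\varphi)},$$ where $A=p\cos\varphi\,\rho^pQ-q\sin\varphi\,\rho^qP$ and $B=\cos\varphi\,\rho^qP+\sin\varphi\,\rho^pQ$, with $P,Q$ evaluated at $(\rho^p\cos\varphi,\rho^q\sin\varphi)$. Let $\rho^k$ be the highest power of $\rho$ that divides both $A$ and $B$, and let $$\mathcal{Z}=\Theta\,\partial_\varphi+R\,\partial_\rho,\qquad \Theta=\frac{A}{\rho^{k}(p\cos^2\varphi+q\sin^2\varphi)},\qquad R=\frac{\rho\,B}{\rho^{k}(p\cos^2\varphi+q\sin^2\varphi)}$$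 be the resulting polar vector field (extended analytically to $\rho=0$), which is $2\pi$-periodic in $\varphi$ and satisfies $R(\varphi,0)=0$. Suppose that there are no characteristic directions, that is, $\Omega_{pq}=\{\varphi\in\mathbb{S}^1:\Theta(\varphi,0)=0\}=\emptyset$, where $\mathbb{S}^1=\mathbb{R}/2\pi\mathbb{Z}$. Then there are $\delta>0$ and a real analytic function $V(\varphi,\rho)$ on the cylinder $C=\{(\varphi,\rho):\varphi\in\mathbb{S}^1,\ 0\le\rho<\delta\}$ (analytic up to and including $\rho=0$) which is an inverse integrating factor of $\mathcal{Z}$, that is, $$\Theta\,\partial_\varphi V+R\,\partial_\rho V=V\,(\partial_\varphi\Theta+\partial_\rho R)\quad\text{on } C\setminus\{\rho=0\},$$ and which has an expansion $$V(\varphi,\rho)=\sum_{j\ge m}v_j(\varphi)\,\rho^j,\qquad 0<\rho<\delta,$$ for some integer $m\ge 0$ and bounded functions $v_j:\mathbb{S}^1\to\mathbb{R}$, with $v_m\not\equiv 0$. -/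

import Mathlib

open Real Set

/-- `γ` is a closed orbit, contained in `D` and surrounding the origin, of the planar vector field
`P ∂x + Q ∂y`: a periodic solution that avoids the origin and such that the connected component
of the origin in the complement of the orbit is bounded. -/
structure IsClosedOrbitAroundOrigin (D : Set (ℝ × ℝ)) (P Q : ℝ × ℝ → ℝ) (γ : ℝ → ℝ × ℝ) :
    Prop where
  mem_domain : ∀ t, γ t ∈ D
  solution : ∀ t, HasDerivAt γ (P (γ t), Q (γ t)) t
  periodic : ∃ T : ℝ, 0 < T ∧ Function.Periodic γ T
  avoids : (0, 0) ∉ range γ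
  surrounds : Bornology.IsBounded (connectedComponentIn (range γ)ᶜ (0, 0))

/-- The origin is a center of the vector field `P ∂x + Q ∂y` with domain `D`: it is a singular
point, and all the nearby trajectories are closed orbits surrounding it. -/
structure IsCenter (D : Set (ℝ × ℝ)) (P Q : ℝ × ℝ → ℝ) : Prop where
  singular : P (0, 0) = 0 ∧ Q (0, 0) = 0
  closed_orbits : ∃ U ∈ nhds ((0, 0) : ℝ × ℝ), ∀ z ∈ U, z ≠ (0, 0) →
    ∃ γ : ℝ → ℝ × ℝ, γ 0 = z ∧ IsClosedOrbitAroundOrigin D P Q γ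

/-- Weighted polar coordinates `x = ρ ^ p * cos φ`, `y = ρ ^ q * sin φ`; the point `z` is
`(φ, ρ)`. The angle runs through `ℝ`, the universal cover of the circle. -/
noncomputable def weightedPolar (p q : ℕ) (z : ℝ × ℝ) : ℝ × ℝ :=
  (z.2 ^ p * cos z.1, z.2 ^ q * sin z.1)

/-- The Jacobian of the weighted polar coordinates is, up to orientation, `ρ ^ (p + q - 1)` times
this positive factor. -/
noncomputable def jacobianFactor (p q : ℕ) (φ : ℝ) : ℝ :=
  p * cos φ ^ 2 + q * sin φ ^ 2

/- In weighted polar coordinates `P ∂x + Q ∂y` reads, for `ρ ≠ 0`,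
`(angularNumerator * ∂φ + ρ * radialNumerator * ∂ρ) / (jacobianFactor * ρ ^ (p + q))`. -/

noncomputable def angularNumerator (P Q : ℝ × ℝ → ℝ) (p q : ℕ) (z : ℝ × ℝ) : ℝ :=
  p * cos z.1 * (z.2 ^ p * Q (weightedPolar p q z)) -
    q * sin z.1 * (z.2 ^ q * P (weightedPolar p q z))

noncomputable def radialNumerator (P Q : ℝ × ℝ → ℝ) (p q : ℕ) (z : ℝ × ℝ) : ℝ :=
  cos z.1 * (z.2 ^ q * P (weightedPolar p q z)) +
    sin z.1 * (z.2 ^ p * Q (weightedPolar p q z))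

/-- The exponent of the highest power of `ρ` that divides both numerators: the least order of a
nonzero term in their expansions in powers of `ρ`. -/
noncomputable def commonOrder (P Q : ℝ × ℝ → ℝ) (p q : ℕ) : ℕ :=
  sInf {n : ℕ | ∃ φ : ℝ,
    iteratedDeriv n (fun ρ => angularNumerator P Q p q (φ, ρ)) 0 ≠ 0 ∨
    iteratedDeriv n (fun ρ => radialNumerator P Q p q (φ, ρ)) 0 ≠ 0}

/-- The component `Θ` of the polar vector field `Θ ∂φ + R ∂ρ`, obtained from `P ∂x + Q ∂y` by
passing to weighted polar coordinates and removing the common power of `ρ`. On `ρ = 0` it is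
the constant term of the resulting power series in `ρ`. -/
noncomputable def polarTheta (P Q : ℝ × ℝ → ℝ) (p q : ℕ) (z : ℝ × ℝ) : ℝ :=
  if z.2 = 0 then
    iteratedDeriv (commonOrder P Q p q) (fun ρ => angularNumerator P Q p q (z.1, ρ)) 0 /
      (Nat.factorial (commonOrder P Q p q) * jacobianFactor p q z.1)
  else
    angularNumerator P Q p q z / (z.2 ^ commonOrder P Q p q * jacobianFactor p q z.1)

/-- The component `R` of the polar vector field `Θ ∂φ + R ∂ρ`; it vanishes on `ρ = 0`. -/
noncomputable def polarR (P Q : ℝ × ℝ → ℝ) (p q : ℕ) (z : ℝ × ℝ) : ℝ :=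
  if z.2 = 0 then 0
  else
    z.2 * radialNumerator P Q p q z / (z.2 ^ commonOrder P Q p q * jacobianFactor p q z.1)

/-- The (angles of the) characteristic directions, `Θ (φ, 0) = 0`. -/
def characteristicDirections (P Q : ℝ × ℝ → ℝ) (p q : ℕ) : Set ℝ :=
  {φ | polarTheta P Q p q (φ, 0) = 0}

/-- The cylinder `0 ≤ ρ < δ`, lifted to the universal cover of the circle. -/
def cylinder (δ : ℝ) : Set (ℝ × ℝ) := {z | 0 ≤ z.2 ∧ z.2 < δ}

/-- The cylinder without the circle `ρ = 0`. -/
def puncturedCylinder (δ : ℝ) : Set (ℝ × ℝ) := {z | 0 < z.2 ∧ z.2 < δ}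

noncomputable def partialPhi (f : ℝ × ℝ → ℝ) (z : ℝ × ℝ) : ℝ := deriv (fun s => f (s, z.2)) z.1

noncomputable def partialRho (f : ℝ × ℝ → ℝ) (z : ℝ × ℝ) : ℝ := deriv (fun s => f (z.1, s)) z.2

/-- `V` is an inverse integrating factor, on the cylinder `0 ≤ ρ < δ`, of the vector field
`Z = Θ ∂φ + R ∂ρ`: it is `2π`-periodic in `φ`, of class `C¹` off `ρ = 0`, and it satisfies there
`Z(V) = V div(Z)`. -/
structure IsInverseIntegratingFactor (Θ R : ℝ × ℝ → ℝ) (δ : ℝ) (V : ℝ × ℝ → ℝ) : Prop where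
  periodic : ∀ z ∈ cylinder δ, V (z.1 + 2 * π, z.2) = V z
  contDiff : ContDiffOn ℝ 1 V (puncturedCylinder δ)
  equation : ∀ z ∈ puncturedCylinder δ,
    Θ z * partialPhi V z + R z * partialRho V z = V z * (partialPhi Θ z + partialRho R z)

/-- `V` has the ascending expansion `V (φ, ρ) = ∑_{j ≥ m} v j φ * ρ ^ j` for `0 < ρ < δ`, with
bounded coefficients on the circle and a leading coefficient `v m` that is not identically
zero. -/
structure HasAscendingExpansion (V : ℝ × ℝ → ℝ) (δ : ℝ) (m : ℤ) (v : ℤ → ℝ → ℝ) : Prop where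
  periodic : ∀ j, m ≤ j → Function.Periodic (v j) (2 * π)
  bounded : ∀ j, m ≤ j → ∃ M : ℝ, ∀ φ, |v j φ| ≤ M
  leading : ∃ φ, v m φ ≠ 0
  expansion : ∀ z ∈ puncturedCylinder δ,
    HasSum (fun n : ℕ => v (m + n) z.1 * z.2 ^ (m + n : ℤ)) (V z)

/-!
In the absence of characteristic directions the orbits of `Θ ∂φ + R ∂ρ` near `ρ = 0` are the graphs
of solutions of `dρ/dφ = ρ G (φ, ρ)`, where `ρ G = R / Θ` and `G` is analytic at every point
`(φ, 0)`. If `H` is a first integral with `∂ρ H ≠ 0`, that is, `∂φ H + ρ G ∂ρ H = 0`, then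
`V = Θ / ∂ρ H` is an inverse integrating factor (`equation_of_firstIntegral`). The proof thus
reduces to finding an analytic and `2 π`-periodic `H`.

The first integral with `H (0, ρ) = ρ` is found as a power series `H = ∑ h j (φ) ρ ^ j`
(`firstIntegral`). Its coefficients solve the linear triangular system
`(h j)' = -∑ k (g i) (h k)`, the sum over `i + k = j`, where `G = ∑ g i (φ) ρ ^ i`. Two majorant
arguments give convergence: `exists_abs_transportSolution_le` bounds the coefficients geometrically
on compact intervals, and `abs_localCoeff_le` bounds their Taylor coefficients at a point, so that
`H` is jointly analytic at every `(φ, 0)` (`SolvesTransportSystem.exists_hasDoubleSeriesAt`). Joint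
analyticity is handled through double series with geometrically bounded coefficients
(`HasDoubleSeriesAt`); they also show that a power of `ρ` can be divided out of an analytic function
(`analyticAt_divPow`), which makes `Θ` and `G` analytic on `ρ = 0`.

The center enters only through periodicity. A level curve of `H` over `[0, 2 π]` is a piece of an
orbit, so on a small closed orbit one can compare the points of the positive half-axis: the one
closest to the origin is a fixed point of `ρ ↦ H (2 π, ρ)`, the inverse of the return map
(`exists_firstIntegral_two_pi_eq`). Fixed points therefore accumulate at `0`, this analytic map is
the identity, and uniqueness for the triangular system makes every `h j` periodic
(`periodic_firstIntegral`).

The expansion of `V` starts at `m = 0`, because `Θ` and `∂ρ H` do not vanish on `ρ = 0`.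
-/

open Filter Topology

/-! ### Double power series -/

/-- `F (z.1 + s, z.2 + t) = ∑ a n i * s ^ n * t ^ i`, with coefficients bounded by
`C * M ^ (n + i)` and for `|s|, |t| < 1 / M`. -/
structure HasDoubleSeriesAt (F : ℝ × ℝ → ℝ) (a : ℕ → ℕ → ℝ) (C M : ℝ) (z : ℝ × ℝ) : Prop where
  pos : 0 < M
  bound : ∀ n i, |a n i| ≤ C * M ^ (n + i)
  hasSum : ∀ s t, |s| * M < 1 → |t| * M < 1 →
    HasSum (fun x : ℕ × ℕ => a x.1 x.2 * s ^ x.1 * t ^ x.2) (F (z.1 + s, z.2 + t))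

lemma summable_const_mul_pow_mul {C M s : ℝ} (hM : 0 < M) (hs : |s| * M < 1) :
    Summable fun n : ℕ => C * M ^ n * |s| ^ n := by
  have h : Summable fun n : ℕ => C * (|s| * M) ^ n :=
    (summable_geometric_of_lt_one (by positivity) hs).mul_left C
  exact h.congr fun n => by rw [mul_pow]; ring

section Series

variable {E : Type*} [NormedAddCommGroup E] [NormedSpace ℝ E] [CompleteSpace E]
  {c : ℕ → E} {C M : ℝ}

lemma summable_pow_smul_of_norm_le (hM : 0 < M) (hc : ∀ n, ‖c n‖ ≤ C * M ^ n) {s : ℝ}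
    (hs : |s| * M < 1) : Summable fun n => s ^ n • c n := by
  refine Summable.of_norm_bounded (summable_const_mul_pow_mul (C := C) hM hs) fun n => ?_
  rw [norm_smul, norm_pow, Real.norm_eq_abs, mul_comm]
  exact mul_le_mul_of_nonneg_right (hc n) (by positivity)

lemma eventually_abs_mul_lt_one (M : ℝ) : ∀ᶠ s : ℝ in 𝓝 0, |s| * M < 1 := by
  have : Tendsto (fun s : ℝ => |s| * M) (𝓝 0) (𝓝 (|0| * M)) := by
    apply Continuous.tendsto; fun_prop
  rw [abs_zero, zero_mul] at this
  exact this.eventually (gt_mem_nhds one_pos)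

lemma analyticAt_tsum_pow_smul (hM : 0 < M) (hc : ∀ n, ‖c n‖ ≤ C * M ^ n) :
    AnalyticAt ℝ (fun s : ℝ => ∑' n, s ^ n • c n) 0 := by
  let p : FormalMultilinearSeries ℝ ℝ E := fun n =>
    ContinuousMultilinearMap.mkPiRing ℝ (Fin n) (c n)
  refine ⟨p, hasFPowerSeriesAt_iff.2 ?_⟩
  filter_upwards [eventually_abs_mul_lt_one M] with s hs
  have : ∀ n, p.coeff n = c n := fun n => by simp [p, FormalMultilinearSeries.coeff]
  simp only [this, zero_add]
  exact (summable_pow_smul_of_norm_le hM hc hs).hasSum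

end Series

lemma hasFPowerSeriesAt_ofScalars_of_hasSum {g : ℝ → ℝ} {c : ℕ → ℝ}
    (h : ∀ᶠ t in 𝓝 0, HasSum (fun i => c i * t ^ i) (g t)) :
    HasFPowerSeriesAt g (FormalMultilinearSeries.ofScalars ℝ c) 0 := by
  refine hasFPowerSeriesAt_iff.2 ?_
  filter_upwards [h] with t ht
  simpa [FormalMultilinearSeries.coeff_ofScalars, mul_comm] using ht

lemma iteratedDeriv_div_factorial_of_hasSum {g : ℝ → ℝ} {c : ℕ → ℝ}
    (h : ∀ᶠ t in 𝓝 0, HasSum (fun i => c i * t ^ i) (g t)) (i : ℕ) :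
    iteratedDeriv i g 0 / i.factorial = c i := by
  have h1 := hasFPowerSeriesAt_ofScalars_of_hasSum h
  have h2 := h1.analyticAt.hasFPowerSeriesAt
  have := congrArg (fun p => p.coeff i) (h2.eq_formalMultilinearSeries h1)
  simpa [FormalMultilinearSeries.coeff_ofScalars] using this

lemma coeff_eq_of_hasSum_of_hasSum {g g' : ℝ → ℝ} {c c' : ℕ → ℝ}
    (h : ∀ᶠ t in 𝓝 0, HasSum (fun i => c i * t ^ i) (g t))
    (h' : ∀ᶠ t in 𝓝 0, HasSum (fun i => c' i * t ^ i) (g' t)) (hg : g =ᶠ[𝓝 0] g') : c = c' := by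
  funext i
  rw [← iteratedDeriv_div_factorial_of_hasSum h, ← iteratedDeriv_div_factorial_of_hasSum h',
    hg.iteratedDeriv_eq]

lemma summable_double_of_bound {a : ℕ → ℕ → ℝ} {C M : ℝ} (hM : 0 < M)
    (ha : ∀ n i, |a n i| ≤ C * M ^ (n + i)) {s t : ℝ} (hs : |s| * M < 1) (ht : |t| * M < 1) :
    Summable fun x : ℕ × ℕ => a x.1 x.2 * s ^ x.1 * t ^ x.2 := by
  have hC : 0 ≤ C := by simpa using (abs_nonneg _).trans (ha 0 0)
  refine Summable.of_norm_bounded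
    ((summable_const_mul_pow_mul (C := C) hM hs).mul_of_nonneg
      (summable_const_mul_pow_mul (C := 1) hM ht) (fun n => by positivity)
      (fun n => by positivity)) fun x => ?_
  rw [norm_mul, norm_mul, norm_pow, norm_pow, Real.norm_eq_abs, Real.norm_eq_abs, Real.norm_eq_abs]
  calc |a x.1 x.2| * |s| ^ x.1 * |t| ^ x.2 ≤ C * M ^ (x.1 + x.2) * |s| ^ x.1 * |t| ^ x.2 := by
        gcongr; exact ha _ _
    _ = _ := by rw [pow_add]; ring

/-- The terms of a multilinear map at `s • e₁ + t • e₂`, grouped by the number of factors `e₁`. -/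
lemma apply_smul_add_smul_eq_sum {N : ℕ} (f : (ℝ × ℝ) [×N]→L[ℝ] ℝ) (s t : ℝ) :
    f (fun _ => (s, t)) = ∑ x ∈ Finset.HasAntidiagonal.antidiagonal N,
      (∑ S ∈ Finset.powersetCard x.1 (Finset.univ : Finset (Fin N)),
        f (S.piecewise (fun _ => (1, 0)) (fun _ => (0, 1)))) * s ^ x.1 * t ^ x.2 := by
  have h1 : (fun _ : Fin N => ((s, t) : ℝ × ℝ)) =
      (fun _ => s • ((1, 0) : ℝ × ℝ)) + fun _ => t • ((0, 1) : ℝ × ℝ) := by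
    funext i; simp
  have h2 : ∀ S : Finset (Fin N),
      f (S.piecewise (fun _ => s • ((1, 0) : ℝ × ℝ)) (fun _ => t • ((0, 1) : ℝ × ℝ))) =
      f (S.piecewise (fun _ => (1, 0)) (fun _ => (0, 1))) * s ^ S.card * t ^ (N - S.card) := by
    intro S
    have : S.piecewise (fun _ => s • ((1, 0) : ℝ × ℝ)) (fun _ => t • ((0, 1) : ℝ × ℝ)) =
        fun i => (if i ∈ S then s else t) •
          (S.piecewise (fun _ => ((1, 0) : ℝ × ℝ)) (fun _ => (0, 1)) : Fin N → ℝ × ℝ) i := by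
      funext i; by_cases hi : i ∈ S <;> simp [hi]
    rw [this, ContinuousMultilinearMap.map_smul_univ, Finset.prod_ite]
    simp only [Finset.prod_const, smul_eq_mul]
    rw [Finset.filter_not, Finset.card_sdiff_of_subset (Finset.filter_subset _ _)]
    simp only [Finset.filter_mem_eq_inter, Finset.univ_inter, Finset.card_univ, Fintype.card_fin]
    ring
  rw [h1, f.map_add_univ, ← Finset.powerset_univ, Finset.sum_powerset,
    Finset.Nat.sum_antidiagonal_eq_sum_range_succ_mk]
  simp only [Finset.card_univ, Fintype.card_fin, Finset.sum_mul]
  refine Finset.sum_congr rfl fun n _ => Finset.sum_congr rfl fun S hS => ?_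
  rw [h2, (Finset.mem_powersetCard.1 hS).2]

theorem AnalyticAt.exists_hasDoubleSeriesAt {F : ℝ × ℝ → ℝ} {z : ℝ × ℝ} (hF : AnalyticAt ℝ F z) :
    ∃ a C M, HasDoubleSeriesAt F a C M z := by
  obtain ⟨p, r, hp⟩ := hF
  obtain ⟨r', hr'0, hr'r⟩ := ENNReal.lt_iff_exists_nnreal_btwn.1 hp.r_pos
  have hr'pos : 0 < r' := by exact_mod_cast hr'0
  obtain ⟨C, hC, hpC⟩ := p.norm_le_div_pow_of_pos_of_lt_radius hr'pos (hr'r.trans_le hp.r_le)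
  have hR : (0 : ℝ) < r' := hr'pos
  -- the binomial number of terms in `a n i` is absorbed by the `2` in the growth rate `2 / r'`
  let a : ℕ → ℕ → ℝ := fun n i => ∑ S ∈ Finset.powersetCard n (Finset.univ : Finset (Fin (n + i))),
    p (n + i) (S.piecewise (fun _ => (1, 0)) (fun _ => (0, 1)))
  have hM : (0 : ℝ) < 2 / r' := by positivity
  have ha : ∀ n i, |a n i| ≤ C * (2 / r') ^ (n + i) := by
    intro n i
    have h1 : ∀ S : Finset (Fin (n + i)),
        |p (n + i) (S.piecewise (fun _ => (1, 0)) (fun _ => (0, 1)))| ≤ C / r' ^ (n + i) := by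
      intro S
      refine ((p (n + i)).le_opNorm _).trans ?_
      have : ∏ j, ‖(S.piecewise (fun _ => ((1, 0) : ℝ × ℝ)) (fun _ => (0, 1)) :
          Fin (n + i) → ℝ × ℝ) j‖ = 1 := by
        refine Finset.prod_eq_one fun j _ => ?_
        by_cases hj : j ∈ S <;> simp [hj, Prod.norm_def]
      rw [this, mul_one]
      exact hpC _
    calc |a n i| ≤ ∑ S ∈ Finset.powersetCard n (Finset.univ : Finset (Fin (n + i))),
          C / r' ^ (n + i) :=
          (Finset.abs_sum_le_sum_abs _ _).trans (Finset.sum_le_sum fun S _ => h1 S)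
      _ = (n + i).choose n * (C / r' ^ (n + i)) := by simp
      _ ≤ 2 ^ (n + i) * (C / r' ^ (n + i)) := by
          gcongr
          exact_mod_cast Nat.choose_le_two_pow _ _
      _ = _ := by rw [div_pow]; ring
  refine ⟨a, C, 2 / r', hM, ha, fun s t hs ht => ?_⟩
  have hsum := summable_double_of_bound hM ha hs ht
  have hmem : ((s, t) : ℝ × ℝ) ∈ Metric.eball (0 : ℝ × ℝ) r := by
    refine Metric.eball_subset_eball hr'r.le ?_
    rw [Metric.eball_coe, mem_ball_zero_iff, Prod.norm_def, max_lt_iff]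
    have h : ∀ x : ℝ, |x| * (2 / r') < 1 → ‖x‖ < r' := fun x hx => by
      rw [← mul_div_assoc, div_lt_one hR] at hx
      rw [Real.norm_eq_abs]
      linarith [abs_nonneg x]
    exact ⟨h s hs, h t ht⟩
  have h1 := hp.hasSum hmem
  have h2 : (fun N => p N fun _ => ((s, t) : ℝ × ℝ)) = fun N =>
      ∑ x ∈ Finset.HasAntidiagonal.antidiagonal N, a x.1 x.2 * s ^ x.1 * t ^ x.2 := by
    funext N
    rw [apply_smul_add_smul_eq_sum]
    refine Finset.sum_congr rfl fun x hx => ?_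
    obtain rfl := Finset.HasAntidiagonal.mem_antidiagonal.1 hx
    rfl
  rw [h2] at h1
  have h3 := (Finset.HasAntidiagonal.sigmaAntidiagonalEquivProd.hasSum_iff.2 hsum.hasSum).sigma
    fun N => hasSum_fintype _
  have h4 : HasSum (fun N => ∑ x ∈ Finset.HasAntidiagonal.antidiagonal N,
      a x.1 x.2 * s ^ x.1 * t ^ x.2) (∑' x : ℕ × ℕ, a x.1 x.2 * s ^ x.1 * t ^ x.2) := by
    refine h3.congr_fun fun N => ?_
    exact (Finset.sum_coe_sort (Finset.HasAntidiagonal.antidiagonal N)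
      fun x : ℕ × ℕ => a x.1 x.2 * s ^ x.1 * t ^ x.2).symm
  exact (h1.unique h4) ▸ hsum.hasSum

lemma tendsto_sub_self_nhds_zero {α : Type*} [TopologicalSpace α] {f : α → ℝ} {z : α}
    (hf : ContinuousAt f z) : Tendsto (fun w => f w - f z) (𝓝 z) (𝓝 0) := by
  simpa using hf.tendsto.sub_const (f z)

/-- A double series is the pairing of a power series in a Banach space with a power series in its
dual; this reduces its analyticity to that of power series in one variable. -/
lemma analyticAt_of_hasSum_pairing {W : Type*} [NormedAddCommGroup W] [NormedSpace ℝ W]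
    [CompleteSpace W] {β : ℕ → W} {ε : ℕ → W →L[ℝ] ℝ} {C M : ℝ} (hM : 0 < M)
    (hβ : ∀ n, ‖β n‖ ≤ C * M ^ n) (hε : ∀ n, ‖ε n‖ ≤ 1 * M ^ n) {F : ℝ × ℝ → ℝ} {z : ℝ × ℝ}
    (h : ∀ s t, |s| * M < 1 → |t| * M < 1 →
      HasSum (fun x : ℕ × ℕ => ε x.2 (β x.1) * s ^ x.1 * t ^ x.2) (F (z.1 + s, z.2 + t))) :
    AnalyticAt ℝ F z := by
  have h1 : AnalyticAt ℝ (fun s : ℝ => ∑' n, s ^ n • β n) 0 := analyticAt_tsum_pow_smul hM hβ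
  have h2 : AnalyticAt ℝ (fun t : ℝ => ∑' i, t ^ i • ε i) 0 := analyticAt_tsum_pow_smul hM hε
  have e1 : AnalyticAt ℝ (fun w : ℝ × ℝ => w.1 - z.1) z := analyticAt_fst.sub analyticAt_const
  have e2 : AnalyticAt ℝ (fun w : ℝ × ℝ => w.2 - z.2) z := analyticAt_snd.sub analyticAt_const
  have h1' := h1.comp_of_eq e1 (sub_self _)
  have h2' := h2.comp_of_eq e2 (sub_self _)
  have h3 := (ContinuousLinearMap.analyticAt_bilinear (ContinuousLinearMap.id ℝ (W →L[ℝ] ℝ))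
    (_, _)).comp₂ h2' h1'
  refine h3.congr ?_
  filter_upwards [(tendsto_sub_self_nhds_zero (continuousAt_fst (p := z))).eventually
    (eventually_abs_mul_lt_one M),
    (tendsto_sub_self_nhds_zero (continuousAt_snd (p := z))).eventually
    (eventually_abs_mul_lt_one M)] with w hs ht
  have hF := h _ _ hs ht
  rw [add_sub_cancel, add_sub_cancel] at hF
  have k1 := (summable_pow_smul_of_norm_le hM hε ht).hasSum
  have k2 := (summable_pow_smul_of_norm_le hM hβ hs).hasSum
  have k3 := k1.mapL (ContinuousLinearMap.apply ℝ ℝ (∑' n, (w.1 - z.1) ^ n • β n))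
  refine k3.unique (((Equiv.prodComm ℕ ℕ).hasSum_iff.2 hF).prod_fiberwise fun i => ?_)
  refine (k2.mapL ((w.2 - z.2) ^ i • ε i)).congr_fun fun n => ?_
  simp [mul_comm, mul_left_comm]

theorem HasDoubleSeriesAt.analyticAt {F : ℝ × ℝ → ℝ} {z : ℝ × ℝ} {a : ℕ → ℕ → ℝ} {C M : ℝ}
    (h : HasDoubleSeriesAt F a C M z) : AnalyticAt ℝ F z := by
  have hM := h.pos
  have hC : 0 ≤ C := by simpa using (abs_nonneg _).trans (h.bound 0 0)
  have hle : ∀ n i, ‖a n i / M ^ i‖ ≤ C * M ^ n := fun n i => by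
    rw [norm_div, norm_pow, Real.norm_eq_abs, Real.norm_eq_abs, abs_of_pos hM,
      div_le_iff₀ (by positivity), mul_assoc, ← pow_add]
    exact h.bound n i
  -- rows scaled by `M ^ (-i)` are bounded sequences; the factor is restored in the dual
  let β : ℕ → BoundedContinuousFunction ℕ ℝ := fun n =>
    BoundedContinuousFunction.ofNormedAddCommGroupDiscrete (fun i => a n i / M ^ i) (C * M ^ n)
      (hle n)
  refine analyticAt_of_hasSum_pairing (β := β)
    (ε := fun i => M ^ i • BoundedContinuousFunction.evalCLM ℝ i) hM
    (fun n => BoundedContinuousFunction.norm_ofNormedAddCommGroup_le _ (by positivity) (hle n))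
    (fun i => ?_) (fun s t hs ht => (h.hasSum s t hs ht).congr_fun fun x => ?_)
  · refine ContinuousLinearMap.opNorm_le_bound _ (by positivity) fun f => ?_
    have : ‖M ^ i * f i‖ ≤ M ^ i * ‖f‖ := by
      rw [norm_mul, norm_pow, Real.norm_eq_abs, abs_of_pos hM]
      exact mul_le_mul_of_nonneg_left (f.norm_coe_le_norm i) (by positivity)
    simpa using this
  · have : a x.1 x.2 = M ^ x.2 * (a x.1 x.2 / M ^ x.2) := by field_simp
    rw [this]
    rfl

/-! ### Expansions in powers of the second variable -/

/-- The coefficient of `ρ ^ j` in the Taylor expansion of `F (φ, ρ)` at `ρ = 0`. -/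
noncomputable def rhoCoeff (F : ℝ × ℝ → ℝ) (j : ℕ) (φ : ℝ) : ℝ :=
  iteratedDeriv j (fun ρ => F (φ, ρ)) 0 / j.factorial

namespace HasDoubleSeriesAt

variable {F : ℝ × ℝ → ℝ} {a : ℕ → ℕ → ℝ} {C M φ₀ : ℝ}

lemma summable_fst (h : HasDoubleSeriesAt F a C M (φ₀, 0)) {s : ℝ} (hs : |s| * M < 1) (i : ℕ) :
    Summable fun n => a n i * s ^ n := by
  refine (summable_pow_smul_of_norm_le (C := C * M ^ i) (c := fun n => a n i) h.pos (fun n => ?_)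
    hs).congr fun n => mul_comm _ _
  rw [mul_assoc, ← pow_add, add_comm i n]
  exact h.bound n i

lemma hasSum_tsum (h : HasDoubleSeriesAt F a C M (φ₀, 0)) {s t : ℝ} (hs : |s| * M < 1)
    (ht : |t| * M < 1) : HasSum (fun i => (∑' n, a n i * s ^ n) * t ^ i) (F (φ₀ + s, t)) := by
  have h1 := h.hasSum s t hs ht
  rw [zero_add] at h1
  exact ((Equiv.prodComm ℕ ℕ).hasSum_iff.2 h1).prod_fiberwise fun i =>
    (h.summable_fst hs i).hasSum.mul_right (t ^ i)

lemma rhoCoeff_eq (h : HasDoubleSeriesAt F a C M (φ₀, 0)) {s : ℝ} (hs : |s| * M < 1) (i : ℕ) :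
    rhoCoeff F i (φ₀ + s) = ∑' n, a n i * s ^ n := by
  refine iteratedDeriv_div_factorial_of_hasSum (c := fun i => ∑' n, a n i * s ^ n) ?_ i
  filter_upwards [eventually_abs_mul_lt_one M] with t ht using h.hasSum_tsum hs ht

lemma hasSum_fst (h : HasDoubleSeriesAt F a C M (φ₀, 0)) {s : ℝ} (hs : |s| * M < 1) (i : ℕ) :
    HasSum (fun n => a n i * s ^ n) (rhoCoeff F i (φ₀ + s)) := by
  rw [h.rhoCoeff_eq hs]
  exact (h.summable_fst hs i).hasSum

lemma hasSum_rhoCoeff (h : HasDoubleSeriesAt F a C M (φ₀, 0)) {s t : ℝ} (hs : |s| * M < 1)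
    (ht : |t| * M < 1) : HasSum (fun i => rhoCoeff F i (φ₀ + s) * t ^ i) (F (φ₀ + s, t)) := by
  simpa only [h.rhoCoeff_eq hs] using h.hasSum_tsum hs ht

lemma abs_rhoCoeff_le (h : HasDoubleSeriesAt F a C M (φ₀, 0)) {s : ℝ} (hs : |s| * M ≤ 1 / 2)
    (i : ℕ) : |rhoCoeff F i (φ₀ + s)| ≤ 2 * C * M ^ i := by
  have hM := h.pos
  have hC : 0 ≤ C := by simpa using (abs_nonneg _).trans (h.bound 0 0)
  have h1 := h.hasSum_fst (hs.trans_lt (by norm_num)) i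
  have h2 : HasSum (fun n => C * M ^ i * (1 / 2 : ℝ) ^ n) (C * M ^ i * 2) :=
    hasSum_geometric_two.mul_left _
  have h3 : ‖rhoCoeff F i (φ₀ + s)‖ ≤ C * M ^ i * 2 := by
    refine h1.norm_le_of_bounded h2 fun n => ?_
    rw [norm_mul, norm_pow, Real.norm_eq_abs, Real.norm_eq_abs]
    calc |a n i| * |s| ^ n ≤ C * M ^ (n + i) * |s| ^ n := by gcongr; exact h.bound n i
      _ = C * M ^ i * (|s| * M) ^ n := by rw [pow_add, mul_pow]; ring
      _ ≤ _ := by gcongr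
  rw [Real.norm_eq_abs] at h3
  linarith

end HasDoubleSeriesAt

lemma analyticAt_of_hasSum_pow {g : ℝ → ℝ} {c : ℕ → ℝ} {x : ℝ}
    (h : ∀ᶠ s in 𝓝 0, HasSum (fun i => c i * s ^ i) (g (x + s))) : AnalyticAt ℝ g x := by
  refine ⟨FormalMultilinearSeries.ofScalars ℝ c, hasFPowerSeriesAt_iff.2 ?_⟩
  filter_upwards [h] with t ht
  simpa [FormalMultilinearSeries.coeff_ofScalars, mul_comm] using ht

lemma analyticAt_rhoCoeff {F : ℝ × ℝ → ℝ} {φ : ℝ} (hF : AnalyticAt ℝ F (φ, 0)) (i : ℕ) :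
    AnalyticAt ℝ (rhoCoeff F i) φ := by
  obtain ⟨a, C, M, h⟩ := hF.exists_hasDoubleSeriesAt
  refine analyticAt_of_hasSum_pow (c := fun n => a n i) ?_
  filter_upwards [eventually_abs_mul_lt_one M] with s hs using h.hasSum_fst hs i

lemma eventually_hasSum_rhoCoeff {F : ℝ × ℝ → ℝ} {φ : ℝ}
    (hF : AnalyticAt ℝ F (φ, 0)) :
    ∀ᶠ z in 𝓝 (φ, (0 : ℝ)), HasSum (fun i => rhoCoeff F i z.1 * z.2 ^ i) (F z) := by
  obtain ⟨a, C, M, h⟩ := hF.exists_hasDoubleSeriesAt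
  filter_upwards [(tendsto_sub_self_nhds_zero (continuousAt_fst (p := (φ, (0 : ℝ))))).eventually
    (eventually_abs_mul_lt_one M), (tendsto_sub_self_nhds_zero
    (continuousAt_snd (p := (φ, (0 : ℝ))))).eventually (eventually_abs_mul_lt_one M)] with z hs ht
  simpa using h.hasSum_rhoCoeff hs ht

/-- The quotient `F z / ρ ^ k`, given on `ρ = 0` by the coefficient of `ρ ^ k` in `F`. -/
noncomputable def divPow (F : ℝ × ℝ → ℝ) (k : ℕ) (z : ℝ × ℝ) : ℝ :=
  if z.2 = 0 then rhoCoeff F k z.1 else F z / z.2 ^ k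

/-- Dividing by `ρ ^ k` shifts the double series of `F`, whose first `k` columns vanish. -/
theorem analyticAt_divPow {F : ℝ × ℝ → ℝ} {φ₀ : ℝ} {k : ℕ} (hF : AnalyticAt ℝ F (φ₀, 0))
    (h0 : ∀ i < k, ∀ φ, rhoCoeff F i φ = 0) : AnalyticAt ℝ (divPow F k) (φ₀, 0) := by
  obtain ⟨a, C, M, h⟩ := hF.exists_hasDoubleSeriesAt
  have hM := h.pos
  have ha : ∀ n i, i < k → a n i = 0 := by
    intro n i hi
    have h1 : ∀ᶠ s in 𝓝 0, HasSum (fun n => a n i * s ^ n) (rhoCoeff F i (φ₀ + s)) := by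
      filter_upwards [eventually_abs_mul_lt_one M] with s hs using h.hasSum_fst hs i
    have h2 : ∀ᶠ s : ℝ in 𝓝 0, HasSum (fun n => (fun _ => (0 : ℝ)) n * s ^ n) 0 :=
      Eventually.of_forall fun s => by simp
    exact congrFun (coeff_eq_of_hasSum_of_hasSum (g' := fun _ => 0) h1 h2
      (Eventually.of_forall fun s => h0 i hi _)) n
  refine HasDoubleSeriesAt.analyticAt (a := fun n i => a n (i + k)) (C := C * M ^ k) (M := M)
    ⟨hM, fun n i => ?_, fun s t hs ht => ?_⟩
  · refine (h.bound n (i + k)).trans_eq ?_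
    rw [← add_assoc, pow_add M (n + i)]; ring
  · rw [zero_add]
    by_cases h0t : t = 0
    · subst h0t
      have hval : divPow F k (φ₀ + s, 0) = rhoCoeff F k (φ₀ + s) := by
        simp [divPow]
      rw [hval]
      have hinj : Function.Injective fun n : ℕ => ((n, 0) : ℕ × ℕ) := fun x y hxy => by
        simpa using hxy
      refine (hinj.hasSum_iff ?_).1 ?_
      · rintro ⟨n, i⟩ hx
        have : i ≠ 0 := by rintro rfl; exact hx ⟨n, rfl⟩
        simp [this]
      · refine (h.hasSum_fst hs k).congr_fun fun n => ?_
        simp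
    · have hval : divPow F k (φ₀ + s, t) = F (φ₀ + s, t) * (t ^ k)⁻¹ := by
        simp [divPow, h0t, div_eq_mul_inv]
      rw [hval]
      have h1 := h.hasSum s t hs ht
      rw [zero_add] at h1
      have hinj : Function.Injective fun x : ℕ × ℕ => ((x.1, x.2 + k) : ℕ × ℕ) := fun x y hxy => by
        simp only [Prod.mk.injEq, add_left_inj] at hxy
        exact Prod.ext hxy.1 hxy.2
      have h2 := ((hinj.hasSum_iff ?_).2 h1).mul_right (t ^ k)⁻¹
      · refine h2.congr_fun fun x => ?_
        simp only [Function.comp, pow_add]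
        field_simp
      · rintro ⟨n, i⟩ hx
        have : i < k := by
          by_contra hi
          exact hx ⟨(n, i - k), by simp [Nat.sub_add_cancel (not_lt.1 hi)]⟩
        simp [ha n i this]

/-! ### The linear system for the coefficients of a first integral -/

open Finset.HasAntidiagonal in
/-- `h` solves on `s` the triangular system that the equation `∂φ H + ρ G ∂ρ H = 0` becomes for the
coefficients of `H = ∑ h j ρ ^ j` and `G = ∑ g i ρ ^ i`. -/
def SolvesTransportSystem (g h : ℕ → ℝ → ℝ) (s : Set ℝ) : Prop :=
  ∀ j, ∀ φ ∈ s, HasDerivAt (h j) (-∑ x ∈ antidiagonal j, x.2 * (g x.1 φ * h x.2 φ)) φ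

lemma sum_antidiagonal_eq_add_sum_range (f : ℕ → ℕ → ℝ) (j : ℕ) :
    ∑ x ∈ Finset.HasAntidiagonal.antidiagonal j, f x.1 x.2 =
      f 0 j + ∑ k ∈ Finset.range j, f (j - k) k := by
  have h := Finset.Nat.sum_antidiagonal_eq_sum_range_succ (fun a b => f b a) j
  rw [← Finset.Nat.sum_antidiagonal_swap] at h
  simp only [Prod.fst_swap, Prod.snd_swap] at h
  rw [h, Finset.sum_range_succ, Nat.sub_self, add_comm]

section System

variable {g : ℕ → ℝ → ℝ}

/-- The solution with value `1` at `0` of `E' = -(g 0) * E`. -/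
noncomputable def integratingFactor (g : ℕ → ℝ → ℝ) (φ : ℝ) : ℝ :=
  exp (-∫ s in (0 : ℝ)..φ, g 0 s)

lemma integratingFactor_pos (φ : ℝ) : 0 < integratingFactor g φ := exp_pos _

lemma integratingFactor_zero : integratingFactor g 0 = 1 := by simp [integratingFactor]

lemma hasDerivAt_integratingFactor (hg : ∀ i, Continuous (g i)) (φ : ℝ) :
    HasDerivAt (integratingFactor g) (-(g 0 φ) * integratingFactor g φ) φ := by
  have h := ((hg 0).integral_hasStrictDerivAt 0 φ).hasDerivAt.neg.exp
  rw [mul_comm] at h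
  exact h

lemma continuous_integratingFactor (hg : ∀ i, Continuous (g i)) :
    Continuous (integratingFactor g) :=
  continuous_iff_continuousAt.2 fun φ => (hasDerivAt_integratingFactor hg φ).continuousAt

/-- The solution of the transport system with `h j 0 = δ j 1`, that is, with `H (0, ρ) = ρ`. -/
noncomputable def transportSolution (g : ℕ → ℝ → ℝ) : ℕ → ℝ → ℝ
  | j => fun φ => integratingFactor g φ ^ j * ((if j = 1 then 1 else 0) -
      ∫ s in (0 : ℝ)..φ, (integratingFactor g s ^ j)⁻¹ *
        ∑ k : Fin j, (k : ℕ) * (g (j - k) s * transportSolution g k s))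
decreasing_by exact k.2

lemma transportSolution_eq (j : ℕ) (φ : ℝ) : transportSolution g j φ =
    integratingFactor g φ ^ j * ((if j = 1 then 1 else 0) -
      ∫ s in (0 : ℝ)..φ, (integratingFactor g s ^ j)⁻¹ *
        ∑ k ∈ Finset.range j, (k : ℝ) * (g (j - k) s * transportSolution g k s)) := by
  rw [transportSolution]
  simp only [Finset.sum_range]

lemma transportSolution_at_zero (j : ℕ) : transportSolution g j 0 = if j = 1 then 1 else 0 := by
  rw [transportSolution_eq]
  simp [integratingFactor_zero]

lemma transportSolution_zero (φ : ℝ) : transportSolution g 0 φ = 0 := by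
  rw [transportSolution_eq]; simp

lemma transportSolution_one (φ : ℝ) : transportSolution g 1 φ = integratingFactor g φ := by
  rw [transportSolution_eq]; simp

lemma continuous_transportSolution (hg : ∀ i, Continuous (g i)) (j : ℕ) :
    Continuous (transportSolution g j) := by
  induction j using Nat.strong_induction_on with
  | _ j ih =>
    have hE := continuous_integratingFactor hg
    have : transportSolution g j = _ := funext fun φ => transportSolution_eq j φ
    rw [this]
    refine (hE.pow j).mul (continuous_const.sub (intervalIntegral.continuous_primitive
      (fun a b => Continuous.intervalIntegrable ?_ a b) 0))
    refine ((hE.pow j).inv₀ fun s => (pow_pos (integratingFactor_pos s) j).ne').mul ?_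
    exact continuous_finsetSum _ fun k hk =>
      continuous_const.mul ((hg _).mul (ih k (Finset.mem_range.1 hk)))

theorem solvesTransportSystem_transportSolution (hg : ∀ i, Continuous (g i)) :
    SolvesTransportSystem g (transportSolution g) univ := by
  intro j φ _
  have hE := continuous_integratingFactor hg
  have hne : ∀ s, integratingFactor g s ^ j ≠ 0 := fun s =>
    (pow_pos (integratingFactor_pos s) j).ne'
  have hc : Continuous fun s => (integratingFactor g s ^ j)⁻¹ *
      ∑ k ∈ Finset.range j, (k : ℝ) * (g (j - k) s * transportSolution g k s) :=
    ((hE.pow j).inv₀ hne).mul (continuous_finsetSum _ fun k _ =>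
      continuous_const.mul ((hg _).mul (continuous_transportSolution hg k)))
  have h1 := ((hasDerivAt_integratingFactor hg φ).pow j).mul
    ((hc.integral_hasStrictDerivAt 0 φ).hasDerivAt.const_sub (if j = 1 then 1 else 0))
  have : transportSolution g j = _ := funext fun φ => transportSolution_eq j φ
  rw [this]
  refine h1.congr_deriv ?_
  rw [sum_antidiagonal_eq_add_sum_range (fun i k => (k : ℝ) * (g i φ * transportSolution g k φ)),
    transportSolution_eq j φ]
  have key : ∀ e a Y S : ℝ, e ≠ 0 →
      (j : ℝ) * e ^ (j - 1) * (-a * e) * Y + e ^ j * -((e ^ j)⁻¹ * S) =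
      -((j : ℝ) * (a * (e ^ j * Y)) + S) := by
    intro e a Y S he
    rw [mul_neg, mul_inv_cancel_left₀ (pow_ne_zero j he)]
    rcases j with _ | j
    · simp
    · rw [Nat.add_sub_cancel, pow_succ]; ring
  exact key _ _ _ _ (integratingFactor_pos φ).ne'

/-- A solution of the transport system is determined by its values at one point. -/
theorem SolvesTransportSystem.eqOn (hg : ∀ i, Continuous (g i)) {h h' : ℕ → ℝ → ℝ} {s : Set ℝ}
    (hs : IsOpen s) (hs' : IsPreconnected s) (hh : SolvesTransportSystem g h s)
    (hh' : SolvesTransportSystem g h' s) {φ₀ : ℝ} (hφ₀ : φ₀ ∈ s) (h0 : ∀ j, h j φ₀ = h' j φ₀)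
    (j : ℕ) : EqOn (h j) (h' j) s := by
  induction j using Nat.strong_induction_on with
  | _ j ih =>
    -- the integrating factor turns the equation for the difference into `f' = 0`
    let f := fun φ => (h j φ - h' j φ) * (integratingFactor g φ ^ j)⁻¹
    have hne : ∀ s, integratingFactor g s ^ j ≠ 0 := fun s =>
      (pow_pos (integratingFactor_pos s) j).ne'
    have hf : ∀ φ ∈ s, HasDerivAt f 0 φ := by
      intro φ hφ
      have h1 := ((hh j φ hφ).sub (hh' j φ hφ)).mul
        (((hasDerivAt_integratingFactor hg φ).pow j).inv (hne φ))
      refine h1.congr_deriv ?_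
      rw [sum_antidiagonal_eq_add_sum_range (fun i k => (k : ℝ) * (g i φ * h k φ)),
        sum_antidiagonal_eq_add_sum_range (fun i k => (k : ℝ) * (g i φ * h' k φ)),
        Finset.sum_congr rfl fun k hk => by rw [ih k (Finset.mem_range.1 hk) hφ]]
      have hne' := hne φ
      have hp := (integratingFactor_pos (g := g) φ).ne'
      simp only [Pi.pow_apply, Pi.inv_apply, Pi.sub_apply]
      rcases j with _ | j
      · simp
      · simp only [Nat.add_sub_cancel, pow_succ] at *
        field_simp
        ring
    intro φ hφ
    have hconst : f φ = f φ₀ := hs.is_const_of_deriv_eq_zero hs'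
      (fun x hx => (hf x hx).differentiableAt.differentiableWithinAt)
      (fun x hx => (hf x hx).deriv) hφ hφ₀
    have : (h j φ - h' j φ) * (integratingFactor g φ ^ j)⁻¹ = 0 := by
      simpa [f, h0] using hconst
    have := (mul_eq_zero.1 this).resolve_right (inv_ne_zero (hne φ))
    linarith

lemma abs_integral_le_of_abs_le_exp {f : ℝ → ℝ} {c l φ : ℝ} (hc : 0 ≤ c) (hl : 0 < l)
    (hf : ∀ s, |s| ≤ |φ| → |f s| ≤ c * exp (l * |s|)) :
    |∫ s in (0 : ℝ)..φ, f s| ≤ c / l * exp (l * |φ|) := by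
  have key : ∀ (f : ℝ → ℝ) (b : ℝ), 0 ≤ b → (∀ s, 0 ≤ s → s ≤ b → |f s| ≤ c * exp (l * s)) →
      |∫ s in (0 : ℝ)..b, f s| ≤ c / l * exp (l * b) := by
    intro f b hb hf
    have h1 : ∀ x ∈ uIcc 0 b, HasDerivAt (fun x => c / l * exp (l * x)) (c * exp (l * x)) x := by
      intro x _
      refine (((hasDerivAt_id x).const_mul l).exp.const_mul (c / l)).congr_deriv ?_
      simp only [id]
      field_simp
    have h2 : Continuous fun x => c * exp (l * x) := by fun_prop
    have h3 := intervalIntegral.norm_integral_le_of_norm_le (f := f) (g := fun x => c * exp (l * x))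
      (μ := MeasureTheory.volume) hb (Eventually.of_forall fun s hs => hf s hs.1.le hs.2)
      (h2.intervalIntegrable 0 b)
    rw [intervalIntegral.integral_eq_sub_of_hasDerivAt h1 (h2.intervalIntegrable 0 b),
      Real.norm_eq_abs] at h3
    have : 0 ≤ c / l * exp (l * 0) := by positivity
    linarith
  rcases le_total 0 φ with h | h
  · rw [abs_of_nonneg h] at hf ⊢
    exact key f φ h fun s h0 h1 => by
      simpa [abs_of_nonneg h0] using hf s (by rwa [abs_of_nonneg h0])
  · have h1 : ∫ s in (0 : ℝ)..φ, f s = -∫ s in (0 : ℝ)..(-φ), f (-s) := by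
      rw [intervalIntegral.integral_comp_neg, neg_neg, neg_zero, intervalIntegral.integral_symm]
    rw [h1, abs_neg, abs_of_nonpos h]
    refine key _ _ (neg_nonneg.2 h) fun s h0 h2 => ?_
    simpa [abs_of_nonneg h0] using hf (-s) (by rwa [abs_neg, abs_of_nonneg h0, abs_of_nonpos h])

lemma sum_range_mul_half_pow_le (j : ℕ) :
    ∑ k ∈ Finset.range j, (k : ℝ) * (1 / 2) ^ (j - k) ≤ j := by
  have h1 : ∀ n : ℕ, ∑ k ∈ Finset.range n, (1 / 2 : ℝ) ^ (n - k) ≤ 1 := by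
    intro n
    induction n with
    | zero => simp
    | succ n ih =>
      rw [Finset.sum_range_succ, Nat.add_sub_cancel_left, pow_one]
      have : ∑ k ∈ Finset.range n, (1 / 2 : ℝ) ^ (n + 1 - k) =
          (∑ k ∈ Finset.range n, (1 / 2 : ℝ) ^ (n - k)) * (1 / 2) := by
        rw [Finset.sum_mul]
        refine Finset.sum_congr rfl fun k hk => ?_
        rw [← pow_succ, Nat.sub_add_comm (Finset.mem_range.1 hk).le]
      rw [this]; linarith
  calc ∑ k ∈ Finset.range j, (k : ℝ) * (1 / 2) ^ (j - k)
      ≤ ∑ k ∈ Finset.range j, (j : ℝ) * (1 / 2) ^ (j - k) := by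
        refine Finset.sum_le_sum fun k hk => ?_
        have : (k : ℝ) ≤ j := by exact_mod_cast (Finset.mem_range.1 hk).le
        gcongr
    _ = j * ∑ k ∈ Finset.range j, (1 / 2 : ℝ) ^ (j - k) := by rw [Finset.mul_sum]
    _ ≤ j * 1 := by gcongr; exact h1 j
    _ = j := mul_one _

/-- Geometric bounds for the coefficients `g i` give geometric bounds for the solution. The factor
`k` in the system is compensated by the exponential weight `exp (k * C * |φ|)`, whose integral gains
a factor `1 / k`. -/
theorem exists_abs_transportSolution_le {L C M : ℝ} (hC : 0 < C) (hM : 0 < M)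
    (hgC : ∀ i φ, |φ| ≤ L → |g i φ| ≤ C * M ^ i) :
    ∃ D K : ℝ, 0 < K ∧ ∀ j φ, |φ| ≤ L → |transportSolution g j φ| ≤ D * K ^ j := by
  have hintg : ∀ φ, |φ| ≤ L → |∫ s in (0 : ℝ)..φ, g 0 s| ≤ C * L := by
    intro φ hφ
    have := intervalIntegral.norm_integral_le_of_norm_le_const (a := (0 : ℝ)) (b := φ) (f := g 0)
      (C := C) fun s hs => by
        have h1 : |s| ≤ |φ| := by
          rcases le_total 0 φ with h | h
          · rw [uIoc_of_le h] at hs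
            rw [abs_of_nonneg h, abs_of_pos hs.1]; exact hs.2
          · rw [uIoc_of_ge h] at hs
            rw [abs_of_nonpos h, abs_of_nonpos hs.2]; linarith [hs.1]
        simpa using hgC 0 s (h1.trans hφ)
    rw [Real.norm_eq_abs, sub_zero] at this
    exact this.trans (by gcongr)
  set B := exp (C * L)
  have hB : 0 < B := exp_pos _
  have hEB : ∀ φ, |φ| ≤ L → integratingFactor g φ ≤ B := fun φ hφ =>
    exp_le_exp.2 (by linarith [neg_abs_le (∫ s in (0 : ℝ)..φ, g 0 s), hintg φ hφ])
  have hEB' : ∀ φ, |φ| ≤ L → (integratingFactor g φ)⁻¹ ≤ B := fun φ hφ => by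
    rw [integratingFactor, ← exp_neg, neg_neg]
    exact exp_le_exp.2 ((le_abs_self _).trans (hintg φ hφ))
  -- twice the growth rate `M * B` of the coefficients of the system freed from `g 0`, so that the
  -- sum over `k < j` becomes a geometric series with ratio `1 / 2`
  set A := 2 * (M * B) with hA
  have hA0 : 0 < A := by positivity
  have main : ∀ j φ, |φ| ≤ L → |transportSolution g j φ| ≤
      integratingFactor g φ ^ j * (A⁻¹ * A ^ j * exp (j * C * |φ|)) := by
    intro j
    induction j using Nat.strong_induction_on with
    | _ j ih =>
      intro φ hφ
      have hE := integratingFactor_pos (g := g)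
      rcases j with _ | _ | n
      · rw [transportSolution_zero]
        simp only [abs_zero]; positivity
      · rw [transportSolution_one, abs_of_pos (hE φ)]
        have : 1 ≤ exp ((0 + 1 : ℕ) * C * |φ|) := one_le_exp (by positivity)
        have h2 : A⁻¹ * A ^ (0 + 1) = 1 := by simp [hA0.ne']
        rw [h2, zero_add, pow_one, one_mul]
        exact le_mul_of_one_le_right (hE φ).le this
      · obtain ⟨j, hj⟩ : ∃ j, j = n + 2 := ⟨_, rfl⟩
        rw [show n + 1 + 1 = j from hj.symm] at ih ⊢
        rw [transportSolution_eq, if_neg (by omega), zero_sub, mul_neg, abs_neg, abs_mul,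
          abs_of_pos (pow_pos (hE φ) j)]
        refine mul_le_mul_of_nonneg_left ?_ (pow_pos (hE φ) j).le
        have hj0 : (0 : ℝ) < j := by rw [hj]; positivity
        have hb := abs_integral_le_of_abs_le_exp (f := fun s => (integratingFactor g s ^ j)⁻¹ *
          ∑ k ∈ Finset.range j, (k : ℝ) * (g (j - k) s * transportSolution g k s))
          (c := C * (A⁻¹ * A ^ j) * j) (l := j * C) (φ := φ) (by positivity) (by positivity) ?_
        · refine hb.trans_eq ?_
          field_simp
        intro s hs
        have hsL := hs.trans hφ
        have hEs := hE s
        rw [abs_mul, abs_of_pos (inv_pos.2 (pow_pos (hE s) j))]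
        have hk : ∀ k ∈ Finset.range j, |(k : ℝ) * (g (j - k) s * transportSolution g k s)| ≤
            (integratingFactor g s ^ j * (C * (A⁻¹ * A ^ j) * exp (j * C * |s|))) *
              (k * (1 / 2) ^ (j - k)) := by
          intro k hk
          have hkj := Finset.mem_range.1 hk
          obtain ⟨m, rfl⟩ : ∃ m, j = k + m := ⟨j - k, by omega⟩
          rw [Nat.add_sub_cancel_left, abs_mul, abs_mul, Nat.abs_cast]
          have h1 := hgC m s hsL
          have h2 := ih k hkj s hsL
          have h3 : exp (k * C * |s|) ≤ exp ((k + m : ℕ) * C * |s|) := by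
            apply exp_le_exp.2
            have : (k : ℝ) ≤ (k + m : ℕ) := by push_cast; linarith [Nat.cast_nonneg (α := ℝ) m]
            gcongr
          have h4 : M ^ m ≤ integratingFactor g s ^ m * ((A ^ m) * (1 / 2) ^ m) := by
            rw [← mul_pow, ← mul_pow]
            refine pow_le_pow_left₀ hM.le ?_ m
            have h5 : 1 ≤ integratingFactor g s * B := by
              have := hEB' s hsL
              rwa [inv_le_iff_one_le_mul₀' hEs] at this
            rw [hA]
            nlinarith
          calc (k : ℝ) * (|g m s| * |transportSolution g k s|)
              ≤ k * ((C * (integratingFactor g s ^ m * ((A ^ m) * (1 / 2) ^ m))) *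
                (integratingFactor g s ^ k * (A⁻¹ * A ^ k * exp ((k + m : ℕ) * C * |s|)))) := by
                gcongr
                · exact h1.trans (by gcongr)
                · exact h2.trans (by gcongr)
            _ = _ := by rw [pow_add, pow_add]; ring
        calc (integratingFactor g s ^ j)⁻¹ *
            |∑ k ∈ Finset.range j, (k : ℝ) * (g (j - k) s * transportSolution g k s)|
            ≤ (integratingFactor g s ^ j)⁻¹ * ∑ k ∈ Finset.range j,
              (integratingFactor g s ^ j * (C * (A⁻¹ * A ^ j) * exp (j * C * |s|))) *
              (k * (1 / 2) ^ (j - k)) := by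
              gcongr
              exact (Finset.abs_sum_le_sum_abs _ _).trans (Finset.sum_le_sum hk)
          _ = C * (A⁻¹ * A ^ j) * exp (j * C * |s|) *
              ∑ k ∈ Finset.range j, (k : ℝ) * (1 / 2) ^ (j - k) := by
              rw [← Finset.mul_sum]
              field_simp
          _ ≤ C * (A⁻¹ * A ^ j) * exp (j * C * |s|) * j := by
              gcongr
              exact sum_range_mul_half_pow_le j
          _ = _ := by ring
  refine ⟨A⁻¹, B * (A * exp (C * L)), by positivity, fun j φ hφ => (main j φ hφ).trans ?_⟩
  have hE := integratingFactor_pos (g := g) φ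
  have h1 : exp (j * C * |φ|) ≤ exp (C * L) ^ j := by
    rw [← exp_nat_mul]
    apply exp_le_exp.2
    rw [mul_assoc]
    gcongr
  calc integratingFactor g φ ^ j * (A⁻¹ * A ^ j * exp (j * C * |φ|))
      ≤ B ^ j * (A⁻¹ * A ^ j * exp (C * L) ^ j) := by
        gcongr
        exact hEB φ hφ
    _ = _ := by rw [mul_pow, mul_pow]; ring

end System

/-! ### Local power series of the solution -/

lemma hasSum_sum_antidiagonal_mul {f g : ℕ → ℝ} {A B : ℝ} (hf : HasSum f A) (hg : HasSum g B) :
    HasSum (fun n => ∑ x ∈ Finset.HasAntidiagonal.antidiagonal n, f x.1 * g x.2) (A * B) := by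
  have hf' := hf.summable.norm
  have hg' := hg.summable.norm
  rw [← hf.tsum_eq, ← hg.tsum_eq, tsum_mul_tsum_eq_tsum_sum_antidiagonal_of_summable_norm hf' hg']
  exact (summable_norm_sum_mul_antidiagonal_of_summable_norm hf' hg').of_norm.hasSum

/-- Termwise differentiation, with the derivative written in the two forms that are compared with
Cauchy products. -/
lemma exists_hasDerivAt_tsum_pow {c : ℕ → ℝ} {D Q t : ℝ} (hQ : 0 < Q)
    (hc : ∀ n, |c n| ≤ D * Q ^ n) (ht : |t| * Q < 1) :
    ∃ d, HasDerivAt (fun t => ∑' n, c n * t ^ n) d t ∧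
      HasSum (fun n : ℕ => (n + 1) * c (n + 1) * t ^ n) d ∧
      HasSum (fun n : ℕ => n * (c n * t ^ n)) (t * d) := by
  have hD : 0 ≤ D := by simpa using (abs_nonneg _).trans (hc 0)
  have ht' : |t| < 1 / Q := by rwa [lt_div_iff₀ hQ]
  obtain ⟨r, htr, hrQ⟩ := exists_between ht'
  have hr : 0 < r := (abs_nonneg t).trans_lt htr
  rw [lt_div_iff₀ hQ] at hrQ
  have hrQ' : ‖r * Q‖ < 1 := by rwa [Real.norm_eq_abs, abs_of_pos (mul_pos hr hQ)]
  have hu0 : Summable fun n : ℕ => (n : ℝ) ^ 1 * (r * Q) ^ n :=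
    summable_pow_mul_geometric_of_norm_lt_one 1 hrQ'
  have hu : Summable fun n : ℕ => D * r⁻¹ * ((n : ℝ) ^ 1 * (r * Q) ^ n) := hu0.mul_left _
  have hbound : ∀ (n : ℕ), ∀ y ∈ Metric.ball (0 : ℝ) r, ‖c n * (n * y ^ (n - 1))‖ ≤
      D * r⁻¹ * ((n : ℝ) ^ 1 * (r * Q) ^ n) := by
    intro n y hy
    rw [mem_ball_zero_iff, Real.norm_eq_abs] at hy
    rw [norm_mul, norm_mul, norm_pow, Real.norm_eq_abs, Real.norm_eq_abs, Real.norm_eq_abs,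
      Nat.abs_cast]
    rcases n with _ | n
    · simp
    · calc |c (n + 1)| * ((n + 1 : ℕ) * |y| ^ (n + 1 - 1))
          ≤ D * Q ^ (n + 1) * ((n + 1 : ℕ) * r ^ n) := by
            rw [Nat.add_sub_cancel]
            gcongr
            exact hc _
        _ = _ := by rw [pow_one, mul_pow, pow_succ r]; field_simp
  have htb : t ∈ Metric.ball (0 : ℝ) r := by
    rwa [mem_ball_zero_iff, Real.norm_eq_abs]
  have h0b : (0 : ℝ) ∈ Metric.ball (0 : ℝ) r := Metric.mem_ball_self hr
  have hs0 : Summable fun n => c n * (0 : ℝ) ^ n :=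
    summable_of_ne_finset_zero (s := {0}) fun n hn => by
      rw [zero_pow (by simpa using hn), mul_zero]
  have hderiv := hasDerivAt_tsum_of_isPreconnected hu Metric.isOpen_ball
    (convex_ball (0 : ℝ) r).isPreconnected
    (fun n y _ => (hasDerivAt_pow n y).const_mul (c n)) hbound h0b hs0 htb
  have hsum : Summable fun n : ℕ => c n * (n * t ^ (n - 1)) :=
    Summable.of_norm_bounded hu fun n => hbound n t htb
  refine ⟨_, hderiv, ?_, ?_⟩
  · have := (hasSum_nat_add_iff' 1).2 hsum.hasSum
    simp only [Finset.sum_range_one, Nat.cast_zero, zero_mul, mul_zero, sub_zero] at this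
    refine this.congr_fun fun n => ?_
    rw [Nat.add_sub_cancel]
    push_cast
    ring
  · refine (hsum.hasSum.mul_left t).congr_fun fun n => ?_
    rcases n with _ | n
    · simp
    · rw [Nat.add_sub_cancel, pow_succ]; ring

section LocalCoeff

open Finset.HasAntidiagonal

/-- The coefficients `b n j` of `(φ - φ₀) ^ n` in the solution `h j` of the transport system, given
the coefficients `a n i` of `g i` and the values `h₀ j` of `h j` at `φ₀`. -/
noncomputable def localCoeff (a : ℕ → ℕ → ℝ) (h₀ : ℕ → ℝ) : ℕ → ℕ → ℝ
  | 0 => h₀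
  | n + 1 => fun j => -(∑ x ∈ antidiagonal j, (x.2 : ℝ) *
      ∑ l : Fin (n + 1), a l x.1 * localCoeff a h₀ (n - l) x.2) / (n + 1)
decreasing_by omega

lemma localCoeff_succ (a : ℕ → ℕ → ℝ) (h₀ : ℕ → ℝ) (n j : ℕ) :
    (n + 1) * localCoeff a h₀ (n + 1) j = -∑ x ∈ antidiagonal j, (x.2 : ℝ) *
      ∑ y ∈ antidiagonal n, a y.1 x.1 * localCoeff a h₀ y.2 x.2 := by
  rw [localCoeff, mul_div_cancel₀ _ (by positivity)]
  simp only [Finset.Nat.sum_antidiagonal_eq_sum_range_succ_mk]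
  simp only [Finset.sum_range]

lemma sum_antidiagonal_pow_mul_pow_le {M A : ℝ} (hM : 0 ≤ M) (hA : 2 * M ≤ A) (n : ℕ) :
    ∑ x ∈ antidiagonal n, M ^ x.1 * A ^ x.2 ≤ 2 * A ^ n := by
  have hA0 : 0 ≤ A := by linarith
  induction n with
  | zero => simp
  | succ n ih =>
    rw [Finset.Nat.sum_antidiagonal_succ]
    simp only [pow_zero, one_mul, pow_succ M, mul_right_comm _ M]
    rw [← Finset.sum_mul, pow_succ]
    nlinarith [pow_nonneg hA0 n]

/-- The binomial coefficient in the bound absorbs the factor `j` on the right of the system, since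
`(n + 1) * choose (n + 1 + j) (n + 1) = (n + 1 + j) * choose (n + j) n`. -/
lemma abs_localCoeff_le {a : ℕ → ℕ → ℝ} {h₀ : ℕ → ℝ} {C M D A β : ℝ} (hM : 0 < M)
    (ha : ∀ n i, |a n i| ≤ C * M ^ (n + i)) (hh₀ : ∀ j, |h₀ j| ≤ D * A ^ j) (hA : 2 * M ≤ A)
    (hβ : 2 * M ≤ β) (hβ' : 4 * C ≤ β) (n j : ℕ) :
    |localCoeff a h₀ n j| ≤ D * A ^ j * β ^ n * (n + j).choose n := by
  have hC : 0 ≤ C := by simpa using (abs_nonneg _).trans (ha 0 0)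
  have hD : 0 ≤ D := by simpa using (abs_nonneg _).trans (hh₀ 0)
  have hA0 : 0 < A := by linarith
  have hβ0 : 0 < β := by linarith
  induction n using Nat.strong_induction_on generalizing j with
  | _ n ih =>
    rcases n with _ | n
    · simpa [localCoeff] using hh₀ j
    have hchoose : ∀ l k, l ≤ n → k ≤ j → (l + k).choose l ≤ (n + j).choose n := by
      intro l k hl hk
      calc (l + k).choose l ≤ (l + j).choose l := Nat.choose_le_choose _ (by omega)
        _ = (l + j).choose j := Nat.choose_symm_add
        _ ≤ (n + j).choose j := Nat.choose_le_choose _ (by omega)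
        _ = (n + j).choose n := Nat.choose_symm_add.symm
    have hpos : (0 : ℝ) < n + 1 := by positivity
    have h1 : (n + 1) * |localCoeff a h₀ (n + 1) j| ≤
        ∑ x ∈ antidiagonal j, (j : ℝ) * ∑ y ∈ antidiagonal n,
          (C * M ^ (y.1 + x.1)) * (D * A ^ x.2 * β ^ y.2 * (n + j).choose n) := by
      have habs : (n + 1) * |localCoeff a h₀ (n + 1) j| =
          |(n + 1) * localCoeff a h₀ (n + 1) j| := by
        rw [abs_mul, abs_of_pos hpos]
      rw [habs, localCoeff_succ, abs_neg]
      refine (Finset.abs_sum_le_sum_abs _ _).trans (Finset.sum_le_sum fun x hx => ?_)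
      have hx2 : x.2 ≤ j := (Nat.le_add_left _ _).trans (mem_antidiagonal.1 hx).le
      rw [abs_mul, Nat.abs_cast]
      have hx2' : (x.2 : ℝ) ≤ j := by exact_mod_cast hx2
      gcongr
      refine (Finset.abs_sum_le_sum_abs _ _).trans (Finset.sum_le_sum fun y hy => ?_)
      have hy2 : y.2 ≤ n := (Nat.le_add_left _ _).trans (mem_antidiagonal.1 hy).le
      rw [abs_mul]
      have h2 : ((y.2 + x.2).choose y.2 : ℝ) ≤ (n + j).choose n := by
        exact_mod_cast hchoose _ _ hy2 hx2
      gcongr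
      · exact ha _ _
      · exact (ih y.2 (by omega) x.2).trans (by gcongr)
    have h3 : ∑ x ∈ antidiagonal j, (j : ℝ) * ∑ y ∈ antidiagonal n,
          (C * M ^ (y.1 + x.1)) * (D * A ^ x.2 * β ^ y.2 * (n + j).choose n) =
        j * C * D * (n + j).choose n * ((∑ x ∈ antidiagonal j, M ^ x.1 * A ^ x.2) *
          ∑ y ∈ antidiagonal n, M ^ y.1 * β ^ y.2) := by
      rw [Finset.sum_mul_sum, Finset.mul_sum]
      refine Finset.sum_congr rfl fun x _ => ?_
      rw [Finset.mul_sum, Finset.mul_sum]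
      refine Finset.sum_congr rfl fun y _ => ?_
      rw [pow_add]; ring
    have h4 : (∑ x ∈ antidiagonal j, M ^ x.1 * A ^ x.2) *
        ∑ y ∈ antidiagonal n, M ^ y.1 * β ^ y.2 ≤ (2 * A ^ j) * (2 * β ^ n) :=
      mul_le_mul (sum_antidiagonal_pow_mul_pow_le hM.le hA j)
        (sum_antidiagonal_pow_mul_pow_le hM.le hβ n)
        (Finset.sum_nonneg fun _ _ => by positivity) (by positivity)
    have h5 : ((n + 1 : ℕ) + j : ℝ) * (n + j).choose n =
        (n + 1 + j).choose (n + 1) * (n + 1 : ℕ) := by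
      have := Nat.add_one_mul_choose_eq (n + j) n
      rw [show n + j + 1 = n + 1 + j by omega] at this
      exact_mod_cast this
    have h6 : (j : ℝ) * (n + j).choose n ≤ (n + 1 + j).choose (n + 1) * (n + 1) := by
      push_cast at h5
      rw [← h5]
      gcongr
      linarith
    refine le_of_mul_le_mul_left ?_ hpos
    calc (n + 1) * |localCoeff a h₀ (n + 1) j|
        ≤ j * C * D * (n + j).choose n * ((2 * A ^ j) * (2 * β ^ n)) := by
          rw [h3] at h1
          exact h1.trans (by gcongr)
      _ = (4 * C) * (D * A ^ j * β ^ n) * (j * (n + j).choose n) := by ring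
      _ ≤ β * (D * A ^ j * β ^ n) * ((n + 1 + j).choose (n + 1) * (n + 1)) := by
          gcongr
      _ = _ := by rw [pow_succ]; ring

end LocalCoeff

/-- The power series with coefficients `localCoeff` solve the transport system. -/
lemma solvesTransportSystem_localCoeff {G : ℝ × ℝ → ℝ} {a : ℕ → ℕ → ℝ} {C M D Q φ₀ : ℝ}
    (ha : HasDoubleSeriesAt G a C M (φ₀, 0)) {h₀ : ℕ → ℝ} (hQ : 0 < Q) (hMQ : M ≤ Q)
    (hb : ∀ j n, |localCoeff a h₀ n j| ≤ D * Q ^ j * Q ^ n) :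
    SolvesTransportSystem (rhoCoeff G) (fun j φ => ∑' n, localCoeff a h₀ n j * (φ - φ₀) ^ n)
      (Metric.ball φ₀ (1 / Q)) := by
  intro j φ hφ
  have ht : |φ - φ₀| * Q < 1 := by
    rwa [Metric.mem_ball, Real.dist_eq, lt_div_iff₀ hQ] at hφ
  have htM : |φ - φ₀| * M < 1 := lt_of_le_of_lt (by gcongr) ht
  obtain ⟨t, rfl⟩ : ∃ t, φ = φ₀ + t := ⟨φ - φ₀, by ring⟩
  rw [add_sub_cancel_left] at ht htM
  obtain ⟨d, hd, hd1, -⟩ := exists_hasDerivAt_tsum_pow hQ (hb j) ht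
  have hsum : ∀ k, HasSum (fun n => localCoeff a h₀ n k * t ^ n)
      (∑' n, localCoeff a h₀ n k * t ^ n) := fun k =>
    ((summable_pow_smul_of_norm_le (c := fun n => localCoeff a h₀ n k) hQ (hb k) ht).congr
      fun n => mul_comm _ _).hasSum
  have h1 : ∀ x : ℕ × ℕ, HasSum (fun n => (x.2 : ℝ) *
        ∑ y ∈ Finset.HasAntidiagonal.antidiagonal n,
          (a y.1 x.1 * t ^ y.1) * (localCoeff a h₀ y.2 x.2 * t ^ y.2))
      ((x.2 : ℝ) * (rhoCoeff G x.1 (φ₀ + t) * ∑' n, localCoeff a h₀ n x.2 * t ^ n)) := fun x =>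
    (hasSum_sum_antidiagonal_mul (ha.hasSum_fst htM x.1) (hsum x.2)).mul_left _
  have h2 := (hasSum_sum (s := Finset.HasAntidiagonal.antidiagonal j) fun x _ => h1 x).neg
  have h3 : ∀ n : ℕ, (n + 1) * localCoeff a h₀ (n + 1) j * t ^ n =
      -∑ x ∈ Finset.HasAntidiagonal.antidiagonal j, (x.2 : ℝ) *
        ∑ y ∈ Finset.HasAntidiagonal.antidiagonal n,
          (a y.1 x.1 * t ^ y.1) * (localCoeff a h₀ y.2 x.2 * t ^ y.2) := by
    intro n
    rw [localCoeff_succ, neg_mul, Finset.sum_mul]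
    congr 1
    refine Finset.sum_congr rfl fun x _ => ?_
    rw [mul_assoc, Finset.sum_mul]
    congr 1
    refine Finset.sum_congr rfl fun y hy => ?_
    rw [← Finset.HasAntidiagonal.mem_antidiagonal.1 hy, pow_add]
    ring
  have h4 := hd1.unique (h2.congr_fun h3)
  have hd' : HasDerivAt (fun φ => ∑' n, localCoeff a h₀ n j * (φ - φ₀) ^ n) d (φ₀ + t) :=
    HasDerivAt.comp_sub_const (f := fun t => ∑' n, localCoeff a h₀ n j * t ^ n) (φ₀ + t) φ₀
      (by rwa [add_sub_cancel_left])
  refine hd'.congr_deriv ?_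
  rw [h4]
  simp only [add_sub_cancel_left]

/-- Near `φ₀` a solution of the transport system is given by power series in `φ - φ₀` with geometric
bounds, if its values at `φ₀` have such bounds. -/
theorem SolvesTransportSystem.exists_hasDoubleSeriesAt {G : ℝ × ℝ → ℝ} {φ₀ : ℝ}
    (hG : ∀ φ, AnalyticAt ℝ G (φ, 0)) {h : ℕ → ℝ → ℝ}
    (hh : SolvesTransportSystem (rhoCoeff G) h univ) {D A : ℝ}
    (hb : ∀ j, |h j φ₀| ≤ D * A ^ j) :
    ∃ b C Q, HasDoubleSeriesAt (fun z => ∑' j, h j z.1 * z.2 ^ j) b C Q (φ₀, 0) := by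
  obtain ⟨a, C, M, ha⟩ := (hG φ₀).exists_hasDoubleSeriesAt
  have hM := ha.pos
  have hD : 0 ≤ D := by simpa using (abs_nonneg _).trans (hb 0)
  have hcont : ∀ i, Continuous (rhoCoeff G i) := fun i =>
    continuous_iff_continuousAt.2 fun φ => (analyticAt_rhoCoeff (hG φ) i).continuousAt
  -- the growth rate that `abs_localCoeff_le` asks for in both variables; it is then doubled to
  -- absorb the binomial coefficients
  set A' := max |A| (max (2 * M) (4 * C))
  have hA'1 : |A| ≤ A' := le_max_left _ _
  have hA'2 : 2 * M ≤ A' := (le_max_left _ _).trans (le_max_right _ _)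
  have hA'3 : 4 * C ≤ A' := (le_max_right _ _).trans (le_max_right _ _)
  have hA'0 : 0 < A' := by linarith
  have hb' : ∀ j, |h j φ₀| ≤ D * A' ^ j := fun j => by
    refine (hb j).trans (mul_le_mul_of_nonneg_left ?_ hD)
    exact (le_abs_self _).trans (by rw [abs_pow]; gcongr)
  have hbnd : ∀ n j, |localCoeff a (fun j => h j φ₀) n j| ≤ D * (2 * A') ^ (n + j) := by
    intro n j
    refine (abs_localCoeff_le hM ha.bound hb' hA'2 hA'2 hA'3 n j).trans ?_
    have h1 : ((n + j).choose n : ℝ) ≤ 2 ^ (n + j) := by exact_mod_cast Nat.choose_le_two_pow _ _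
    calc D * A' ^ j * A' ^ n * (n + j).choose n ≤ D * A' ^ j * A' ^ n * 2 ^ (n + j) := by gcongr
      _ = _ := by rw [mul_pow, pow_add A']; ring
  obtain ⟨Q, hQdef⟩ : ∃ Q, Q = 2 * A' := ⟨_, rfl⟩
  rw [← hQdef] at hbnd
  have hQ : 0 < Q := by rw [hQdef]; positivity
  have hbnd' : ∀ j n, |localCoeff a (fun j => h j φ₀) n j| ≤ D * Q ^ j * Q ^ n := fun j n => by
    rw [mul_assoc, ← pow_add, add_comm j]; exact hbnd n j
  have hS := solvesTransportSystem_localCoeff ha hQ (by linarith) hbnd'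
  generalize hbdef : localCoeff a (fun j => h j φ₀) = b at *
  have hb0 : ∀ j, b 0 j = h j φ₀ := fun j => by rw [← hbdef, localCoeff]
  have heq := hS.eqOn hcont Metric.isOpen_ball
    (convex_ball φ₀ (1 / Q)).isPreconnected (fun j φ _ => hh j φ (mem_univ _))
    (Metric.mem_ball_self (by positivity)) (fun j => by
      rw [sub_self, ← hb0 j, tsum_eq_single 0 fun n hn => by rw [zero_pow hn, mul_zero]]
      simp)
  refine ⟨b, D, Q, hQ, hbnd, fun s t hs ht => ?_⟩
  have hsum := (summable_double_of_bound hQ hbnd hs ht).hasSum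
  have hmem : φ₀ + s ∈ Metric.ball φ₀ (1 / Q) := by
    rw [Metric.mem_ball, Real.dist_eq, add_sub_cancel_left, lt_div_iff₀ hQ]
    exact hs
  have h0 : ∀ j, HasSum (fun n => b n j * s ^ n) (h j (φ₀ + s)) := fun j => by
    have h1 := heq j hmem
    simp only [add_sub_cancel_left] at h1
    rw [← h1]
    exact ((summable_pow_smul_of_norm_le (c := fun n => b n j) hQ (hbnd' j) hs).congr
      fun n => mul_comm _ _).hasSum
  have h1 := ((Equiv.prodComm ℕ ℕ).hasSum_iff.2 hsum).prod_fiberwise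
    fun j => (h0 j).mul_right (t ^ j)
  simp only [zero_add, h1.tsum_eq]
  exact hsum

/-! ### The analytic first integral -/

lemma exists_abs_rhoCoeff_le {G : ℝ × ℝ → ℝ} (hG : ∀ φ, AnalyticAt ℝ G (φ, 0)) {K : Set ℝ}
    (hK : IsCompact K) :
    ∃ C M : ℝ, 0 < C ∧ 0 < M ∧ ∀ i, ∀ φ ∈ K, |rhoCoeff G i φ| ≤ C * M ^ i := by
  refine hK.induction_on (p := fun s => ∃ C M : ℝ, 0 < C ∧ 0 < M ∧ ∀ i, ∀ φ ∈ s,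
    |rhoCoeff G i φ| ≤ C * M ^ i) ⟨1, 1, one_pos, one_pos, by simp⟩ ?_ ?_ ?_
  · rintro s t hst ⟨C, M, hC, hM, h⟩
    exact ⟨C, M, hC, hM, fun i φ hφ => h i φ (hst hφ)⟩
  · rintro s t ⟨C, M, hC, hM, h⟩ ⟨C', M', hC', hM', h'⟩
    refine ⟨max C C', max M M', lt_max_of_lt_left hC, lt_max_of_lt_left hM, ?_⟩
    rintro i φ (hφ | hφ)
    · refine (h i φ hφ).trans ?_
      gcongr
      exacts [le_max_left _ _, le_max_left _ _]
    · refine (h' i φ hφ).trans ?_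
      gcongr
      exacts [le_max_right _ _, le_max_right _ _]
  · intro φ₀ _
    obtain ⟨a, C, M, h⟩ := (hG φ₀).exists_hasDoubleSeriesAt
    have hC : 0 ≤ C := by simpa using (abs_nonneg _).trans (h.bound 0 0)
    have h1 : Tendsto (fun φ => |φ - φ₀| * M) (𝓝 φ₀) (𝓝 (|φ₀ - φ₀| * M)) := by
      apply Continuous.tendsto; fun_prop
    rw [sub_self, abs_zero, zero_mul] at h1
    refine ⟨_, mem_nhdsWithin_of_mem_nhds (h1.eventually (ge_mem_nhds one_half_pos)),
      2 * C + 1, M, by positivity, h.pos, fun i φ hφ => ?_⟩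
    have h2 := h.abs_rhoCoeff_le (s := φ - φ₀) hφ i
    rw [add_sub_cancel] at h2
    have := pow_pos h.pos i
    linarith

lemma continuous_rhoCoeff {G : ℝ × ℝ → ℝ} (hG : ∀ φ, AnalyticAt ℝ G (φ, 0)) (i : ℕ) :
    Continuous (rhoCoeff G i) :=
  continuous_iff_continuousAt.2 fun φ => (analyticAt_rhoCoeff (hG φ) i).continuousAt

/-- The function `H` with `∂φ H + ρ G ∂ρ H = 0` and `H (0, ρ) = ρ`, given by its expansion in powers
of `ρ`. -/
noncomputable def firstIntegral (G : ℝ × ℝ → ℝ) (z : ℝ × ℝ) : ℝ :=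
  ∑' j, transportSolution (rhoCoeff G) j z.1 * z.2 ^ j

section FirstIntegral

variable {G : ℝ × ℝ → ℝ}

lemma firstIntegral_zero_left (ρ : ℝ) : firstIntegral G (0, ρ) = ρ := by
  rw [firstIntegral, tsum_eq_single 1]
  · simp [transportSolution_at_zero]
  · intro j hj
    simp [transportSolution_at_zero, hj]

lemma firstIntegral_zero_right (φ : ℝ) : firstIntegral G (φ, 0) = 0 := by
  rw [firstIntegral, tsum_eq_single 0]
  · simp [transportSolution_zero]
  · intro j hj
    simp [hj]

lemma exists_abs_transportSolution_rhoCoeff_le (hG : ∀ φ, AnalyticAt ℝ G (φ, 0)) (L : ℝ) :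
    ∃ D K : ℝ, 0 < K ∧
      ∀ j φ, |φ| ≤ L → |transportSolution (rhoCoeff G) j φ| ≤ D * K ^ j := by
  obtain ⟨C, M, hC, hM, h⟩ := exists_abs_rhoCoeff_le hG (isCompact_Icc (a := -L) (b := L))
  exact exists_abs_transportSolution_le hC hM fun i φ hφ => h i φ (abs_le.1 hφ)

lemma analyticAt_firstIntegral (hG : ∀ φ, AnalyticAt ℝ G (φ, 0)) (φ : ℝ) :
    AnalyticAt ℝ (firstIntegral G) (φ, 0) := by
  obtain ⟨D, K, -, h⟩ := exists_abs_transportSolution_rhoCoeff_le hG |φ|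
  obtain ⟨b, C, Q, hbC⟩ := (solvesTransportSystem_transportSolution
    (continuous_rhoCoeff hG)).exists_hasDoubleSeriesAt hG fun j => h j φ le_rfl
  exact hbC.analyticAt

lemma eventually_hasSum_firstIntegral (hG : ∀ φ, AnalyticAt ℝ G (φ, 0)) (φ : ℝ) :
    ∀ᶠ ρ in 𝓝 (0 : ℝ), HasSum (fun j => transportSolution (rhoCoeff G) j φ * ρ ^ j)
      (firstIntegral G (φ, ρ)) := by
  obtain ⟨D, K, hK, h⟩ := exists_abs_transportSolution_rhoCoeff_le hG |φ|
  filter_upwards [eventually_abs_mul_lt_one K] with ρ hρ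
  exact ((summable_pow_smul_of_norm_le (c := fun j => transportSolution (rhoCoeff G) j φ) hK
    (fun j => h j φ le_rfl) hρ).congr fun n => mul_comm _ _).hasSum

/-- The first integral satisfies `∂φ H + ρ G ∂ρ H = 0`. -/
theorem eventually_hasDerivAt_firstIntegral (hG : ∀ φ, AnalyticAt ℝ G (φ, 0)) (φ₀ : ℝ) :
    ∀ᶠ z in 𝓝 (φ₀, (0 : ℝ)), ∃ d,
      HasDerivAt (fun s => firstIntegral G (s, z.2)) (-(z.2 * G z * d)) z.1 ∧
      HasDerivAt (fun t => firstIntegral G (z.1, t)) d z.2 := by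
  obtain ⟨C, M, hC, hM, hg⟩ := exists_abs_rhoCoeff_le hG
    (isCompact_Icc (a := -(|φ₀| + 1)) (b := |φ₀| + 1))
  obtain ⟨D, K', hK', hh'⟩ := exists_abs_transportSolution_rhoCoeff_le hG (|φ₀| + 1)
  have hD : 0 ≤ D := by
    simpa using (abs_nonneg _).trans (hh' 0 φ₀ (by linarith))
  obtain ⟨K, hK'K, hMK⟩ : ∃ K, K' ≤ K ∧ 2 * M ≤ K := ⟨_, le_max_left _ _, le_max_right _ _⟩
  have hK : 0 < K := hK'.trans_le hK'K
  have hh : ∀ j φ, |φ| ≤ |φ₀| + 1 → |transportSolution (rhoCoeff G) j φ| ≤ D * K ^ j :=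
    fun j φ hφ => (hh' j φ hφ).trans (by gcongr)
  have hball : ∀ φ ∈ Metric.ball φ₀ 1, |φ| ≤ |φ₀| + 1 := fun φ hφ => by
    rw [Metric.mem_ball, Real.dist_eq] at hφ
    have := abs_add_le (φ - φ₀) φ₀
    rw [sub_add_cancel] at this
    linarith
  have hsol := solvesTransportSystem_transportSolution (continuous_rhoCoeff hG)
  have hnear : ∀ᶠ z in 𝓝 (φ₀, (0 : ℝ)), z.1 ∈ Metric.ball φ₀ 1 :=
    continuousAt_fst.eventually (Metric.ball_mem_nhds _ one_pos)
  filter_upwards [hnear,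
    (tendsto_sub_self_nhds_zero (continuousAt_snd (p := (φ₀, (0 : ℝ))))).eventually
    (eventually_abs_mul_lt_one K), eventually_hasSum_rhoCoeff (hG φ₀)] with z hz hρ hGz
  rw [sub_zero] at hρ
  simp only [firstIntegral]
  generalize transportSolution (rhoCoeff G) = h at *
  obtain ⟨d, hd, -, hd1⟩ := exists_hasDerivAt_tsum_pow hK (fun j => hh j z.1 (hball _ hz)) hρ
  refine ⟨d, ?_, hd⟩
  have hbound : ∀ j : ℕ, ∀ φ ∈ Metric.ball φ₀ 1,
      ‖(-∑ x ∈ Finset.HasAntidiagonal.antidiagonal j,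
        (x.2 : ℝ) * (rhoCoeff G x.1 φ * h x.2 φ)) * z.2 ^ j‖ ≤
      2 * C * D * ((j : ℝ) ^ 1 * (|z.2| * K) ^ j) := by
    intro j φ hφ
    rw [norm_mul, norm_neg, norm_pow, Real.norm_eq_abs, Real.norm_eq_abs]
    have h1 : |∑ x ∈ Finset.HasAntidiagonal.antidiagonal j,
        (x.2 : ℝ) * (rhoCoeff G x.1 φ * h x.2 φ)| ≤
        ∑ x ∈ Finset.HasAntidiagonal.antidiagonal j, j * C * D * (M ^ x.1 * K ^ x.2) := by
      refine (Finset.abs_sum_le_sum_abs _ _).trans (Finset.sum_le_sum fun x hx => ?_)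
      have hx2 : (x.2 : ℝ) ≤ j := by
        exact_mod_cast (Nat.le_add_left _ _).trans (Finset.HasAntidiagonal.mem_antidiagonal.1 hx).le
      rw [abs_mul, abs_mul, Nat.abs_cast]
      calc (x.2 : ℝ) * (|rhoCoeff G x.1 φ| * |h x.2 φ|)
          ≤ j * ((C * M ^ x.1) * (D * K ^ x.2)) := by
            gcongr
            · exact hg _ _ (abs_le.1 (hball φ hφ))
            · exact hh _ _ (hball φ hφ)
        _ = _ := by ring
    rw [← Finset.mul_sum] at h1
    calc _ ≤ j * C * D * (2 * K ^ j) * |z.2| ^ j := by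
          gcongr
          exact h1.trans (by gcongr; exact sum_antidiagonal_pow_mul_pow_le hM.le hMK j)
      _ = _ := by rw [mul_pow, pow_one]; ring
  have hρ' : ‖|z.2| * K‖ < 1 := by rwa [Real.norm_eq_abs, abs_of_nonneg (by positivity)]
  have hu0 : Summable fun j : ℕ => (j : ℝ) ^ 1 * (|z.2| * K) ^ j :=
    summable_pow_mul_geometric_of_norm_lt_one 1 hρ'
  have hu : Summable fun j : ℕ => 2 * C * D * ((j : ℝ) ^ 1 * (|z.2| * K) ^ j) := hu0.mul_left _
  have hs : Summable fun j => h j z.1 * z.2 ^ j :=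
    (summable_pow_smul_of_norm_le (c := fun j => h j z.1) hK
      (fun j => hh j z.1 (hball _ hz)) hρ).congr fun n => mul_comm _ _
  have hderiv : HasDerivAt (fun φ => ∑' j, h j φ * z.2 ^ j)
      (∑' j : ℕ, (-∑ x ∈ Finset.HasAntidiagonal.antidiagonal j,
        (x.2 : ℝ) * (rhoCoeff G x.1 z.1 * h x.2 z.1)) * z.2 ^ j) z.1 :=
    hasDerivAt_tsum_of_isPreconnected (g := fun j φ => h j φ * z.2 ^ j) hu Metric.isOpen_ball
      (convex_ball φ₀ 1).isPreconnected
      (fun j φ _ => (hsol j φ (mem_univ _)).mul_const _) hbound hz hs hz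
  refine hderiv.congr_deriv ?_
  have hprod := (hasSum_sum_antidiagonal_mul hGz hd1).neg
  rw [show -(z.2 * G z * d) = -(G z * (z.2 * d)) by ring, ← hprod.tsum_eq]
  refine tsum_congr fun j => ?_
  rw [neg_mul, Finset.sum_mul]
  congr 1
  refine Finset.sum_congr rfl fun x hx => ?_
  rw [← Finset.HasAntidiagonal.mem_antidiagonal.1 hx, pow_add]
  ring

lemma hasDerivAt_firstIntegral_zero (hG : ∀ φ, AnalyticAt ℝ G (φ, 0)) (φ : ℝ) :
    HasDerivAt (fun t => firstIntegral G (φ, t)) (integratingFactor (rhoCoeff G) φ) 0 := by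
  have h1 := iteratedDeriv_div_factorial_of_hasSum (eventually_hasSum_firstIntegral hG φ) 1
  rw [iteratedDeriv_one, Nat.factorial_one, Nat.cast_one, div_one, transportSolution_one] at h1
  rw [← h1]
  have h2 : AnalyticAt ℝ (fun t => firstIntegral G (φ, t)) 0 :=
    (analyticAt_firstIntegral hG φ).comp_of_eq (analyticAt_const.prod analyticAt_id) rfl
  exact h2.differentiableAt.hasDerivAt

/-- If the return map `ρ ↦ H (2 π, ρ)` has fixed points accumulating at `0`, it is the identity, and
the first integral is `2 π`-periodic. -/
theorem periodic_firstIntegral (hG : ∀ φ, AnalyticAt ℝ G (φ, 0))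
    (hper : ∀ z : ℝ × ℝ, G (z.1 + 2 * π, z.2) = G z)
    (hfix : ∃ᶠ ρ in 𝓝[≠] 0, firstIntegral G (2 * π, ρ) = ρ) (z : ℝ × ℝ) :
    firstIntegral G (z.1 + 2 * π, z.2) = firstIntegral G z := by
  have h1 : AnalyticAt ℝ (fun t => firstIntegral G (2 * π, t)) 0 :=
    (analyticAt_firstIntegral hG (2 * π)).comp_of_eq (analyticAt_const.prod analyticAt_id) rfl
  have h2 : ∀ᶠ ρ in 𝓝 0, firstIntegral G (2 * π, ρ) = ρ :=
    (h1.frequently_eq_iff_eventually_eq analyticAt_id).1 hfix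
  have h3 := coeff_eq_of_hasSum_of_hasSum (eventually_hasSum_firstIntegral hG (2 * π))
    (eventually_hasSum_firstIntegral hG 0)
    (h2.mono fun ρ hρ => hρ.trans (firstIntegral_zero_left ρ).symm)
  have hgper : ∀ i φ, rhoCoeff G i (φ + 2 * π) = rhoCoeff G i φ := fun i φ => by
    have : (fun ρ => G (φ + 2 * π, ρ)) = fun ρ => G (φ, ρ) := funext fun ρ => hper (φ, ρ)
    simp only [rhoCoeff, this]
  have hsol := solvesTransportSystem_transportSolution (continuous_rhoCoeff hG)
  have hsol' : SolvesTransportSystem (rhoCoeff G)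
      (fun j φ => transportSolution (rhoCoeff G) j (φ + 2 * π)) univ := by
    intro j φ _
    have := (hsol j (φ + 2 * π) (mem_univ _)).comp_add_const φ (2 * π)
    simpa only [hgper] using this
  have h4 := fun j => hsol'.eqOn (continuous_rhoCoeff hG) isOpen_univ isPreconnected_univ hsol
    (mem_univ 0) (fun j => by simpa using congrFun h3 j) j
  simp only [firstIntegral]
  exact tsum_congr fun j => congrArg (· * z.2 ^ j) (h4 j (mem_univ z.1))

end FirstIntegral

/-! ### Level curves of the first integral and closed orbits -/

/-- A tube lemma for the segment `[α, β] × {0}`. -/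
lemma exists_forall_of_eventually_nhds {α β : ℝ} {p : ℝ × ℝ → Prop}
    (h : ∀ φ, ∀ᶠ z in 𝓝 (φ, (0 : ℝ)), p z) :
    ∃ δ > 0, ∀ z : ℝ × ℝ, z.1 ∈ Icc α β → |z.2| ≤ δ → p z := by
  have h1 : ∀ᶠ ρ in 𝓝 (0 : ℝ), ∀ φ ∈ Icc α β, p (φ, ρ) := by
    refine isCompact_Icc.eventually_forall_of_forall_eventually
      (P := fun ρ φ => p (φ, ρ)) fun φ _ => ?_
    exact (continuous_swap.tendsto ((0 : ℝ), φ)).eventually (h φ)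
  obtain ⟨δ, hδ, h2⟩ := Metric.eventually_nhds_iff.1 h1
  refine ⟨δ / 2, half_pos hδ, fun z hz hz' => h2 ?_ z.1 hz⟩
  rw [Real.dist_eq, sub_zero]
  linarith

/-- Near `ρ = 0`, the level sets of a function `H` that vanishes on `ρ = 0`, increases with `ρ` and
satisfies `∂φ H + ρ G ∂ρ H = 0` are graphs of solutions of `dρ/dφ = ρ G (φ, ρ)`. -/
lemma exists_level_curve {H G : ℝ × ℝ → ℝ} {α β δ : ℝ} (hαβ : α ≤ β) (hδ : 0 < δ)
    (hH0 : ∀ φ, H (φ, 0) = 0)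
    (hH : ∀ z : ℝ × ℝ, z.1 ∈ Icc α β → |z.2| ≤ δ → AnalyticAt ℝ H z)
    (hd : ∀ z : ℝ × ℝ, z.1 ∈ Icc α β → |z.2| ≤ δ → ∃ d > 0,
      HasDerivAt (fun s => H (s, z.2)) (-(z.2 * G z * d)) z.1 ∧
      HasDerivAt (fun t => H (z.1, t)) d z.2) :
    (∀ φ ∈ Icc α β, StrictMonoOn (fun ρ => H (φ, ρ)) (Icc 0 δ)) ∧
    ∃ s₀ > 0, ∀ s ∈ Ioo 0 s₀, ∃ u : ℝ → ℝ, ∀ φ ∈ Ioo α β, u φ ∈ Ioo 0 δ ∧ H (φ, u φ) = s ∧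
      HasDerivAt u (u φ * G (φ, u φ)) φ := by
  have habs : ∀ ρ ∈ Icc 0 δ, |ρ| ≤ δ := fun ρ hρ => by rw [abs_of_nonneg hρ.1]; exact hρ.2
  have hcont : ∀ φ ∈ Icc α β, ContinuousOn (fun ρ => H (φ, ρ)) (Icc 0 δ) := by
    intro φ hφ ρ hρ
    obtain ⟨d, -, -, h2⟩ := hd (φ, ρ) hφ (habs ρ hρ)
    exact h2.continuousAt.continuousWithinAt
  have hmono : ∀ φ ∈ Icc α β, StrictMonoOn (fun ρ => H (φ, ρ)) (Icc 0 δ) := by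
    intro φ hφ
    refine strictMonoOn_of_deriv_pos (convex_Icc 0 δ) (hcont φ hφ) fun ρ hρ => ?_
    obtain ⟨d, hd0, -, h2⟩ := hd (φ, ρ) hφ (habs ρ (interior_subset hρ))
    rw [h2.deriv]
    exact hd0
  refine ⟨hmono, ?_⟩
  have hcontδ : ContinuousOn (fun φ => H (φ, δ)) (Icc α β) := by
    intro φ hφ
    obtain ⟨d, -, h1, -⟩ := hd (φ, δ) hφ (habs δ ⟨hδ.le, le_rfl⟩)
    exact h1.continuousAt.continuousWithinAt
  obtain ⟨φm, hφm, hmin⟩ := isCompact_Icc.exists_isMinOn (nonempty_Icc.2 hαβ) hcontδ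
  refine ⟨H (φm, δ), ?_, fun s hs => ?_⟩
  · have := hmono φm hφm (left_mem_Icc.2 hδ.le) (right_mem_Icc.2 hδ.le) hδ
    simpa [hH0] using this
  have hex : ∀ φ ∈ Icc α β, ∃ ρ ∈ Ioo 0 δ, H (φ, ρ) = s := by
    intro φ hφ
    refine intermediate_value_Ioo hδ.le (hcont φ hφ) ⟨?_, ?_⟩
    · simpa [hH0] using hs.1
    · exact hs.2.trans_le (hmin hφ)
  choose! u hu1 hu2 using hex
  refine ⟨u, fun φ hφ => ?_⟩
  have hφ' := Ioo_subset_Icc_self hφ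
  refine ⟨hu1 φ hφ', hu2 φ hφ', ?_⟩
  have hz := habs _ (Ioo_subset_Icc_self (hu1 φ hφ'))
  obtain ⟨d, hd0, h1, h2⟩ := hd (φ, u φ) hφ' hz
  have hF := (hH (φ, u φ) hφ' hz).hasStrictFDerivAt
  set F := fderiv ℝ H (φ, u φ)
  have e1 : F (1, 0) = -(u φ * G (φ, u φ) * d) := by
    have h3 : HasDerivAt (fun s : ℝ => (s, u φ)) ((1 : ℝ), (0 : ℝ)) φ :=
      (hasDerivAt_id φ).prodMk (hasDerivAt_const φ (u φ))
    exact (hF.hasFDerivAt.comp_hasDerivAt φ h3).unique h1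
  have e2 : F (0, 1) = d := by
    have h3 : HasDerivAt (fun t : ℝ => (φ, t)) ((0 : ℝ), (1 : ℝ)) (u φ) :=
      (hasDerivAt_const (u φ) φ).prodMk (hasDerivAt_id (u φ))
    exact (hF.hasFDerivAt.comp_hasDerivAt (u φ) h3).unique h2
  have hinv : (F ∘L .inr ℝ ℝ ℝ).IsInvertible :=
    ⟨ContinuousLinearEquiv.unitsEquivAut ℝ (Units.mk0 d hd0.ne'), by ext; simp [e2]⟩
  set ψ := hF.implicitFunctionOfProdDomain hinv
  have hψt : Tendsto ψ (𝓝 φ) (𝓝 (u φ)) := hF.tendsto_implicitFunctionOfProdDomain hinv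
  have hψ : ∀ᶠ x in 𝓝 φ, H (x, ψ x) = H (φ, u φ) :=
    hF.eventually_apply_implicitFunctionOfProdDomain hinv
  have huψ : u =ᶠ[𝓝 φ] ψ := by
    filter_upwards [hψ, hψt.eventually (Ioo_mem_nhds (hu1 φ hφ').1 (hu1 φ hφ').2),
      Ioo_mem_nhds hφ.1 hφ.2] with x hx hx1 hx2
    have hx3 := Ioo_subset_Icc_self hx2
    refine (hmono x hx3).injOn (Ioo_subset_Icc_self (hu1 x hx3)) (Ioo_subset_Icc_self hx1) ?_
    rw [hx, hu2 x hx3, hu2 φ hφ']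
  have hψd : DifferentiableAt ℝ ψ φ :=
    (hF.hasStrictFDerivAt_implicitFunctionOfProdDomain hinv).hasFDerivAt.differentiableAt
  have hud : HasDerivAt u (deriv u φ) φ := (hψd.congr_of_eventuallyEq huψ).hasDerivAt
  have hcomp : HasDerivAt (fun x => H (x, u x)) (F (1, deriv u φ)) φ :=
    HasFDerivAt.comp_hasDerivAt φ hF.hasFDerivAt ((hasDerivAt_id φ).prodMk hud)
  have hconst : HasDerivAt (fun x => H (x, u x)) 0 φ := by
    refine (hasDerivAt_const φ s).congr_of_eventuallyEq ?_
    filter_upwards [Ioo_mem_nhds hφ.1 hφ.2] with x hx using hu2 x (Ioo_subset_Icc_self hx)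
  have h0 := hcomp.unique hconst
  have hsplit : ((1 : ℝ), deriv u φ) = (1, 0) + deriv u φ • ((0 : ℝ), (1 : ℝ)) := by simp
  rw [hsplit, map_add, map_smul, e1, e2, smul_eq_mul] at h0
  have : deriv u φ = u φ * G (φ, u φ) := by
    apply mul_right_cancel₀ hd0.ne'
    linarith
  rwa [this] at hud

/-- A curve whose velocity is a continuous multiple of an analytic vector field stays on the orbit
through one of its points. -/
lemma mem_range_of_hasDerivAt_smul {D : Set (ℝ × ℝ)} {X : ℝ × ℝ → ℝ × ℝ}
    (hX : AnalyticOnNhd ℝ X D) {γ : ℝ → ℝ × ℝ} (hγD : ∀ t, γ t ∈ D)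
    (hγ : ∀ t, HasDerivAt γ (X (γ t)) t) {c : ℝ → ℝ × ℝ} {g : ℝ → ℝ} {α β : ℝ}
    (hc : ∀ φ ∈ Ioo α β, HasDerivAt c (g φ • X (c φ)) φ) (hcD : ∀ φ ∈ Ioo α β, c φ ∈ D)
    (hg : ContinuousOn g (Ioo α β)) {φ₀ φ₁ : ℝ} (h₀ : φ₀ ∈ Ioo α β) (h₁ : φ₁ ∈ Ioo α β)
    (hmem : c φ₀ ∈ range γ) : c φ₁ ∈ range γ := by
  obtain ⟨a, ha, ha'⟩ := exists_between (lt_min h₀.1 h₁.1)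
  obtain ⟨b, hb, hb'⟩ := exists_between (max_lt h₀.2 h₁.2)
  rw [lt_min_iff] at ha'
  rw [max_lt_iff] at hb
  have hab : a ≤ b := (ha'.1.trans hb.1).le
  have hsub : Icc a b ⊆ Ioo α β := fun x hx => ⟨ha.trans_le hx.1, hx.2.trans_lt hb'⟩
  obtain ⟨t₀, ht₀⟩ := hmem
  -- `g` is made continuous on `ℝ`, so that its primitive `τ` is a change of time: both `c` and
  -- `γ ∘ τ` solve the equation `dx/dφ = g φ • X x`
  let g' : ℝ → ℝ := fun x => g (projIcc a b hab x)
  have hg' : Continuous g' :=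
    (continuousOn_iff_continuous_domRestrict.1 (hg.mono hsub)).comp continuous_projIcc
  have hgg' : ∀ x ∈ Icc a b, g' x = g x := fun x hx => by
    simp only [g', projIcc_of_mem hab hx]
  let τ : ℝ → ℝ := fun φ => t₀ + ∫ s in φ₀..φ, g' s
  have hτ : ∀ φ, HasDerivAt τ (g' φ) φ := fun φ =>
    (hg'.integral_hasStrictDerivAt φ₀ φ).hasDerivAt.const_add t₀
  have hγτ : ∀ φ, HasDerivAt (γ ∘ τ) (g' φ • X (γ (τ φ))) φ := fun φ => (hγ (τ φ)).scomp φ (hτ φ)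
  have hγτc : Continuous (γ ∘ τ) :=
    continuous_iff_continuousAt.2 fun φ => (hγτ φ).continuousAt
  have hcc : ContinuousOn c (Icc a b) := fun φ hφ =>
    (hc φ (hsub hφ)).continuousAt.continuousWithinAt
  let K := c '' Icc a b ∪ (γ ∘ τ) '' Icc a b
  have hK : IsCompact K := (isCompact_Icc.image_of_continuousOn hcc).union
    (isCompact_Icc.image hγτc)
  have hKD : K ⊆ D := by
    rintro _ (⟨φ, hφ, rfl⟩ | ⟨φ, -, rfl⟩)
    exacts [hcD φ (hsub hφ), hγD _]
  obtain ⟨L, hL⟩ := LocallyLipschitzOn.exists_lipschitzOnWith_of_compact (f := X) hK fun x hx => by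
    obtain ⟨L, t, ht, hL⟩ := ((hX x (hKD hx)).contDiffAt (n := 1)) |>.exists_lipschitzOnWith
    exact ⟨L, t, mem_nhdsWithin_of_mem_nhds ht, hL⟩
  obtain ⟨N, hN⟩ := isCompact_Icc.exists_bound_of_continuousOn hg'.continuousOn (s := Icc a b)
  have hlip : ∀ φ ∈ Ioo a b, LipschitzOnWith (N.toNNReal * L) (fun x => g' φ • X x) K := by
    intro φ hφ
    refine LipschitzOnWith.of_dist_le_mul fun x hx y hy => ?_
    rw [dist_smul₀, NNReal.coe_mul, mul_assoc]
    exact mul_le_mul ((hN φ (Ioo_subset_Icc_self hφ)).trans (le_coe_toNNReal N))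
      (hL.dist_le_mul x hx y hy) dist_nonneg (NNReal.coe_nonneg _)
  have heq := ODE_solution_unique_of_mem_Ioo (v := fun φ x => g' φ • X x) (s := fun _ => K)
    (f := c) (g := γ ∘ τ) hlip ⟨ha'.1, hb.1⟩
    (fun φ hφ => ⟨by
      have hφ' := Ioo_subset_Icc_self hφ
      simp only [hgg' φ hφ']
      exact hc φ (hsub hφ'), Or.inl ⟨φ, Ioo_subset_Icc_self hφ, rfl⟩⟩)
    (fun φ hφ => ⟨hγτ φ, Or.inr ⟨φ, Ioo_subset_Icc_self hφ, rfl⟩⟩)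
    (by simp [τ, ht₀])
  exact ⟨τ φ₁, (heq ⟨ha'.2, hb.2⟩).symm⟩

/-- A solution `u` of `dρ/dφ = ρ B / A` gives a curve along the vector field `P ∂x + Q ∂y`. -/
lemma hasDerivAt_weightedPolar {P Q : ℝ × ℝ → ℝ} {p q : ℕ} (hp : 0 < p) (hq : 0 < q) {u : ℝ → ℝ}
    {φ : ℝ} (hA : angularNumerator P Q p q (φ, u φ) ≠ 0)
    (hu : HasDerivAt u (u φ * (radialNumerator P Q p q (φ, u φ) /
      angularNumerator P Q p q (φ, u φ))) φ) :
    HasDerivAt (fun φ => weightedPolar p q (φ, u φ))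
      ((u φ ^ (p + q) * jacobianFactor p q φ / angularNumerator P Q p q (φ, u φ)) •
        (P (weightedPolar p q (φ, u φ)), Q (weightedPolar p q (φ, u φ)))) φ := by
  have h1 := (hu.pow p).mul (hasDerivAt_cos φ)
  have h2 := (hu.pow q).mul (hasDerivAt_sin φ)
  refine (h1.prodMk h2).congr_deriv ?_
  have hpow : ∀ n : ℕ, 0 < n → ∀ x y : ℝ, (n : ℝ) * x ^ (n - 1) * (x * y) = n * x ^ n * y := by
    intro n hn x y
    obtain ⟨m, rfl⟩ := Nat.exists_eq_succ_of_ne_zero hn.ne'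
    rw [Nat.succ_sub_one, pow_succ]; ring
  rw [hpow p hp, hpow q hq]
  generalize hAdef : angularNumerator P Q p q (φ, u φ) = A at *
  generalize hBdef : radialNumerator P Q p q (φ, u φ) = B at *
  simp only [angularNumerator, radialNumerator] at hAdef hBdef
  simp only [Prod.smul_mk, smul_eq_mul, Prod.mk.injEq, jacobianFactor, Pi.pow_apply]
  generalize P (weightedPolar p q (φ, u φ)) = P' at *
  generalize Q (weightedPolar p q (φ, u φ)) = Q' at *
  constructor
  · field_simp
    rw [← hAdef, ← hBdef, pow_add]
    ring
  · field_simp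
    rw [← hAdef, ← hBdef, pow_add]
    ring

/-- Among the points of a small closed orbit on the positive half-axis, the one closest to the
origin is fixed by the return map: neither its image nor its preimage can be closer. -/
theorem exists_firstIntegral_two_pi_eq {D : Set (ℝ × ℝ)} {P Q G : ℝ × ℝ → ℝ}
    (hP : AnalyticOnNhd ℝ P D) (hQ : AnalyticOnNhd ℝ Q D) (hcenter : IsCenter D P Q) {p q : ℕ}
    (hp : 0 < p) (hq : 0 < q) (hG : ∀ φ, AnalyticAt ℝ G (φ, 0))
    (hD : ∀ φ, ∀ᶠ z in 𝓝 (φ, (0 : ℝ)), weightedPolar p q z ∈ D)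
    (hA : ∀ φ, ∀ᶠ z in 𝓝 (φ, (0 : ℝ)), 0 < z.2 → angularNumerator P Q p q z ≠ 0 ∧
      G z = radialNumerator P Q p q z / angularNumerator P Q p q z) {ε : ℝ} (hε : 0 < ε) :
    ∃ r ∈ Ioo 0 ε, firstIntegral G (2 * π, r) = r := by
  set H := firstIntegral G with hHdef
  have hpos : ∀ φ, ∀ᶠ z in 𝓝 (φ, (0 : ℝ)), ∃ d > 0,
      HasDerivAt (fun s => H (s, z.2)) (-(z.2 * G z * d)) z.1 ∧
      HasDerivAt (fun t => H (z.1, t)) d z.2 := by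
    intro φ
    have hd : ∀ z, AnalyticAt ℝ H z → HasDerivAt (fun t => H (z.1, t)) (fderiv ℝ H z (0, 1)) z.2 :=
      fun z hz => by
        have h3 : HasDerivAt (fun t : ℝ => (z.1, t)) ((0 : ℝ), (1 : ℝ)) z.2 :=
          (hasDerivAt_const z.2 z.1).prodMk (hasDerivAt_id z.2)
        exact HasFDerivAt.comp_hasDerivAt z.2 hz.differentiableAt.hasFDerivAt h3
    have h0 := analyticAt_firstIntegral hG φ
    have h1 : 0 < fderiv ℝ H (φ, 0) (0, 1) := by
      rw [(hd _ h0).unique (hasDerivAt_firstIntegral_zero hG φ)]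
      exact integratingFactor_pos φ
    have h2 : ContinuousAt (fun z => fderiv ℝ H z (0, 1)) (φ, 0) :=
      h0.fderiv.continuousAt.clm_apply continuousAt_const
    filter_upwards [eventually_hasDerivAt_firstIntegral hG φ, h0.eventually_analyticAt,
      h2.eventually (lt_mem_nhds h1)] with z ⟨d, hz1, hz2⟩ hz3 hz4
    rw [(hd z hz3).unique hz2] at hz4
    exact ⟨d, hz4, hz1, hz2⟩
  -- any open interval that contains `[0, 2 π]` would do in place of `(-1, 7)`
  obtain ⟨δ, hδ, hall⟩ := exists_forall_of_eventually_nhds (α := -1) (β := 7) fun φ =>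
    (analyticAt_firstIntegral hG φ).eventually_analyticAt.and ((hpos φ).and ((hD φ).and (hA φ)))
  obtain ⟨hmono, s₀, hs₀, hlevel⟩ := exists_level_curve (α := -1) (β := 7) (H := H) (G := G)
    (by norm_num) hδ firstIntegral_zero_right (fun z h1 h2 => (hall z h1 h2).1)
    fun z h1 h2 => (hall z h1 h2).2.1
  have hXan : AnalyticOnNhd ℝ (fun z => (P z, Q z)) D := fun z hz => (hP z hz).prod (hQ z hz)
  have mem0 : (0 : ℝ) ∈ Ioo (-1 : ℝ) 7 := by norm_num
  have mem2 : 2 * π ∈ Ioo (-1 : ℝ) 7 := ⟨by linarith [pi_pos], by linarith [pi_lt_d2]⟩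
  -- a level curve over `[0, 2 π]` that has one end on an orbit has both ends on it
  have hends : ∀ γ, IsClosedOrbitAroundOrigin D P Q γ → ∀ u : ℝ → ℝ,
      (∀ φ ∈ Ioo (-1 : ℝ) 7, u φ ∈ Ioo 0 δ ∧ HasDerivAt u (u φ * G (φ, u φ)) φ) →
      (((u 0 ^ p, 0) : ℝ × ℝ) ∈ range γ ↔ ((u (2 * π) ^ p, 0) : ℝ × ℝ) ∈ range γ) := by
    intro γ hγ u hu
    have hz : ∀ φ ∈ Ioo (-1 : ℝ) 7, weightedPolar p q (φ, u φ) ∈ D ∧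
        angularNumerator P Q p q (φ, u φ) ≠ 0 ∧
        G (φ, u φ) = radialNumerator P Q p q (φ, u φ) / angularNumerator P Q p q (φ, u φ) := by
      intro φ hφ
      have h1 := (hu φ hφ).1
      have h2 := hall (φ, u φ) (Ioo_subset_Icc_self hφ) (by
        rw [abs_of_pos h1.1]; exact h1.2.le)
      exact ⟨h2.2.2.1, h2.2.2.2 h1.1⟩
    have hc : ∀ φ ∈ Ioo (-1 : ℝ) 7, HasDerivAt (fun φ => weightedPolar p q (φ, u φ))
        ((u φ ^ (p + q) * jacobianFactor p q φ / angularNumerator P Q p q (φ, u φ)) •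
          (P (weightedPolar p q (φ, u φ)), Q (weightedPolar p q (φ, u φ)))) φ := fun φ hφ => by
      refine hasDerivAt_weightedPolar hp hq (hz φ hφ).2.1 ?_
      rw [← (hz φ hφ).2.2]
      exact (hu φ hφ).2
    have hcont : ContinuousOn (fun φ => u φ ^ (p + q) * jacobianFactor p q φ /
        angularNumerator P Q p q (φ, u φ)) (Ioo (-1) 7) := by
      intro φ hφ
      refine ContinuousAt.continuousWithinAt ?_
      have hu' := (hu φ hφ).2.continuousAt
      have hPc : ContinuousAt (fun φ => P (weightedPolar p q (φ, u φ))) φ :=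
        ContinuousAt.comp (f := fun φ => weightedPolar p q (φ, u φ))
          (hP _ (hz φ hφ).1).continuousAt (hc φ hφ).continuousAt
      have hQc : ContinuousAt (fun φ => Q (weightedPolar p q (φ, u φ))) φ :=
        ContinuousAt.comp (f := fun φ => weightedPolar p q (φ, u φ))
          (hQ _ (hz φ hφ).1).continuousAt (hc φ hφ).continuousAt
      refine ContinuousAt.div ?_ ?_ (hz φ hφ).2.1
      · unfold jacobianFactor
        fun_prop
      · have hcos := continuous_cos.continuousAt (x := φ)
        have hsin := continuous_sin.continuousAt (x := φ)
        exact ((continuousAt_const.mul hcos).mul ((hu'.pow p).mul hQc)).sub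
          ((continuousAt_const.mul hsin).mul ((hu'.pow q).mul hPc))
    have key : ∀ φ₀ ∈ Ioo (-1 : ℝ) 7, ∀ φ₁ ∈ Ioo (-1 : ℝ) 7,
        weightedPolar p q (φ₀, u φ₀) ∈ range γ → weightedPolar p q (φ₁, u φ₁) ∈ range γ :=
      fun φ₀ h₀ φ₁ h₁ hmem => mem_range_of_hasDerivAt_smul hXan hγ.mem_domain hγ.solution hc
        (fun φ hφ => (hz φ hφ).1) hcont h₀ h₁ hmem
    have e0 : weightedPolar p q (0, u 0) = (u 0 ^ p, 0) := by simp [weightedPolar]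
    have e1 : weightedPolar p q (2 * π, u (2 * π)) = (u (2 * π) ^ p, 0) := by simp [weightedPolar]
    rw [← e0, ← e1]
    exact ⟨key _ mem0 _ mem2, key _ mem2 _ mem0⟩
  obtain ⟨U, hU, hUorb⟩ := hcenter.closed_orbits
  have hcontp : Continuous fun r : ℝ => ((r ^ p, 0) : ℝ × ℝ) := by fun_prop
  have hUr : ∀ᶠ r in 𝓝[>] (0 : ℝ), ((r ^ p, 0) : ℝ × ℝ) ∈ U := by
    refine (hcontp.tendsto' 0 (0, 0) ?_).mono_left nhdsWithin_le_nhds hU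
    simp [hp.ne']
  obtain ⟨r₀, ⟨hr₀U, hr₀⟩⟩ := (hUr.and (Ioo_mem_nhdsGT (lt_min hε hs₀))).exists
  obtain ⟨γ, hγ0, hγ⟩ := hUorb (r₀ ^ p, 0) hr₀U fun h => (pow_pos hr₀.1 p).ne' (Prod.mk.inj h).1
  have hγc : Continuous γ := continuous_iff_continuousAt.2 fun t => (hγ.solution t).continuousAt
  obtain ⟨T, hT, hTper⟩ := hγ.periodic
  have hcomp : IsCompact (range γ) := hTper.compact_of_continuous hT.ne' hγc
  have hScomp : IsCompact (Icc 0 r₀ ∩ (fun r : ℝ => ((r ^ p, 0) : ℝ × ℝ)) ⁻¹' range γ) :=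
    isCompact_Icc.inter_right (hcomp.isClosed.preimage hcontp)
  obtain ⟨r, ⟨⟨hr0, hrr₀⟩, hrγ⟩, hleast⟩ := hScomp.exists_isLeast
    ⟨r₀, ⟨hr₀.1.le, le_rfl⟩, ⟨0, hγ0⟩⟩
  have hrpos : 0 < r := by
    refine hr0.lt_of_ne fun h => hγ.avoids ?_
    rw [mem_preimage, ← h, zero_pow hp.ne'] at hrγ
    exact hrγ
  have hrs₀ : r < s₀ := hrr₀.trans_lt (hr₀.2.trans_le (min_le_right _ _))
  -- the level curve that starts at `r` ends on the orbit, hence not below `r`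
  obtain ⟨u, hu⟩ := hlevel r ⟨hrpos, hrs₀⟩
  have hu0 : u 0 = r := by
    have := (hu 0 mem0).2.1
    rwa [hHdef, firstIntegral_zero_left] at this
  have hru : r ≤ u (2 * π) := by
    have h1 := (hends γ hγ u fun φ hφ => ⟨(hu φ hφ).1, (hu φ hφ).2.2⟩).1 (by rw [hu0]; exact hrγ)
    rcases le_total (u (2 * π)) r₀ with h | h
    · exact hleast ⟨⟨(hu _ mem2).1.1.le, h⟩, h1⟩
    · exact hrr₀.trans h
  have hu2 := hu _ mem2
  have hrδ : r ∈ Icc 0 δ := ⟨hr0, hru.trans hu2.1.2.le⟩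
  have hmono2 := hmono (2 * π) (Ioo_subset_Icc_self mem2)
  have hle : H (2 * π, r) ≤ r :=
    (hmono2.monotoneOn hrδ (Ioo_subset_Icc_self hu2.1) hru).trans_eq hu2.2.1
  have hHpos : 0 < H (2 * π, r) := by
    have := hmono2 (left_mem_Icc.2 hδ.le) hrδ hrpos
    simpa [hHdef, firstIntegral_zero_right] using this
  -- the level curve that ends at `r` starts on the orbit at `H (2 π, r)`, hence not below `r`
  obtain ⟨w, hw⟩ := hlevel (H (2 * π, r)) ⟨hHpos, hle.trans_lt hrs₀⟩
  have hw0 : w 0 = H (2 * π, r) := by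
    have := (hw 0 mem0).2.1
    rwa [hHdef, firstIntegral_zero_left] at this
  have hw2 : w (2 * π) = r :=
    hmono2.injOn (Ioo_subset_Icc_self (hw _ mem2).1) hrδ (hw _ mem2).2.1
  have h2 := (hends γ hγ w fun φ hφ => ⟨(hw φ hφ).1, (hw φ hφ).2.2⟩).2 (by rw [hw2]; exact hrγ)
  rw [hw0] at h2
  have hge : r ≤ H (2 * π, r) := hleast ⟨⟨hHpos.le, hle.trans hrr₀⟩, h2⟩
  exact ⟨r, ⟨hrpos, hrr₀.trans_lt (hr₀.2.trans_le (min_le_left _ _))⟩, le_antisymm hle hge⟩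

/-! ### The inverse integrating factor of a first integral -/

lemma hasDerivAt_partialPhi {F : ℝ × ℝ → ℝ} {z : ℝ × ℝ} (hF : DifferentiableAt ℝ F z) :
    HasDerivAt (fun s => F (s, z.2)) (partialPhi F z) z.1 ∧
      partialPhi F z = fderiv ℝ F z (1, 0) := by
  have h : HasDerivAt (fun s : ℝ => (s, z.2)) ((1 : ℝ), (0 : ℝ)) z.1 :=
    (hasDerivAt_id z.1).prodMk (hasDerivAt_const z.1 z.2)
  have h1 : HasDerivAt (fun s => F (s, z.2)) (fderiv ℝ F z (1, 0)) z.1 :=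
    HasFDerivAt.comp_hasDerivAt z.1 hF.hasFDerivAt h
  exact ⟨h1.differentiableAt.hasDerivAt, h1.deriv⟩

lemma hasDerivAt_partialRho {F : ℝ × ℝ → ℝ} {z : ℝ × ℝ} (hF : DifferentiableAt ℝ F z) :
    HasDerivAt (fun t => F (z.1, t)) (partialRho F z) z.2 ∧
      partialRho F z = fderiv ℝ F z (0, 1) := by
  have h : HasDerivAt (fun t : ℝ => (z.1, t)) ((0 : ℝ), (1 : ℝ)) z.2 :=
    (hasDerivAt_const z.2 z.1).prodMk (hasDerivAt_id z.2)
  have h1 : HasDerivAt (fun t => F (z.1, t)) (fderiv ℝ F z (0, 1)) z.2 :=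
    HasFDerivAt.comp_hasDerivAt z.2 hF.hasFDerivAt h
  exact ⟨h1.differentiableAt.hasDerivAt, h1.deriv⟩

lemma partialRho_eventuallyEq {H : ℝ × ℝ → ℝ} {z : ℝ × ℝ} (hH : AnalyticAt ℝ H z) :
    partialRho H =ᶠ[𝓝 z] fun w => fderiv ℝ H w (0, 1) := by
  filter_upwards [hH.eventually_analyticAt] with w hw
  exact (hasDerivAt_partialRho hw.differentiableAt).2

lemma partialPhi_eventuallyEq {H : ℝ × ℝ → ℝ} {z : ℝ × ℝ} (hH : AnalyticAt ℝ H z) :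
    partialPhi H =ᶠ[𝓝 z] fun w => fderiv ℝ H w (1, 0) := by
  filter_upwards [hH.eventually_analyticAt] with w hw
  exact (hasDerivAt_partialPhi hw.differentiableAt).2

lemma analyticAt_partialRho {H : ℝ × ℝ → ℝ} {z : ℝ × ℝ} (hH : AnalyticAt ℝ H z) :
    AnalyticAt ℝ (partialRho H) z :=
  (((ContinuousLinearMap.apply ℝ ℝ ((0 : ℝ), (1 : ℝ))).analyticAt _).comp hH.fderiv).congr
    (partialRho_eventuallyEq hH).symm

lemma partialPhi_partialRho_comm {H : ℝ × ℝ → ℝ} {z : ℝ × ℝ} (hH : AnalyticAt ℝ H z) :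
    partialPhi (partialRho H) z = partialRho (partialPhi H) z := by
  have hd : HasFDerivAt (fderiv ℝ H) (fderiv ℝ (fderiv ℝ H) z) z :=
    hH.fderiv.differentiableAt.hasFDerivAt
  have hev : ∀ v, HasFDerivAt (fun w => fderiv ℝ H w v)
      ((ContinuousLinearMap.apply ℝ ℝ v).comp (fderiv ℝ (fderiv ℝ H) z)) z := fun v =>
    (ContinuousLinearMap.apply ℝ ℝ v).hasFDerivAt.comp z hd
  have h1 := (hev (0, 1)).congr_of_eventuallyEq (partialRho_eventuallyEq hH)
  have h2 := (hev (1, 0)).congr_of_eventuallyEq (partialPhi_eventuallyEq hH)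
  rw [(hasDerivAt_partialPhi h1.differentiableAt).2, (hasDerivAt_partialRho h2.differentiableAt).2,
    h1.fderiv, h2.fderiv]
  have hsymm : IsSymmSndFDerivAt ℝ H z := (hH.contDiffAt (n := 2)).isSymmSndFDerivAt (by simp)
  exact hsymm (1, 0) (0, 1)

/-- If `∂φ H + ρ G ∂ρ H = 0` and `R = ρ G Θ`, then `Θ / ∂ρ H` is an inverse integrating factor of
`Θ ∂φ + R ∂ρ`. -/
lemma equation_of_firstIntegral {H G Θ R V : ℝ × ℝ → ℝ} {z : ℝ × ℝ} (hH : AnalyticAt ℝ H z)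
    (hG : AnalyticAt ℝ G z) (hΘ : AnalyticAt ℝ Θ z) (hR : R =ᶠ[𝓝 z] fun w => w.2 * G w * Θ w)
    (hV : ∀ w, V w = Θ w / partialRho H w)
    (hpde : ∀ᶠ w in 𝓝 z, partialPhi H w = -(w.2 * G w * partialRho H w))
    (hu : partialRho H z ≠ 0) :
    Θ z * partialPhi V z + R z * partialRho V z = V z * (partialPhi Θ z + partialRho R z) := by
  have hpath : Tendsto (fun t : ℝ => (z.1, t)) (𝓝 z.2) (𝓝 z) := by
    have : Continuous fun t : ℝ => (z.1, t) := by fun_prop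
    exact this.tendsto z.2
  have hU := analyticAt_partialRho hH
  obtain ⟨U1, -⟩ := hasDerivAt_partialPhi hU.differentiableAt
  obtain ⟨U2, -⟩ := hasDerivAt_partialRho hU.differentiableAt
  obtain ⟨T1, -⟩ := hasDerivAt_partialPhi hΘ.differentiableAt
  obtain ⟨T2, -⟩ := hasDerivAt_partialRho hΘ.differentiableAt
  obtain ⟨G2, -⟩ := hasDerivAt_partialRho hG.differentiableAt
  have hV1 : partialPhi V z = (partialPhi Θ z * partialRho H z -
      Θ z * partialPhi (partialRho H) z) / partialRho H z ^ 2 := by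
    have : (fun s => V (s, z.2)) = fun s => Θ (s, z.2) / partialRho H (s, z.2) :=
      funext fun s => hV _
    rw [partialPhi, this]
    exact (T1.fun_div U1 hu).deriv
  have hV2 : partialRho V z = (partialRho Θ z * partialRho H z -
      Θ z * partialRho (partialRho H) z) / partialRho H z ^ 2 := by
    have : (fun t => V (z.1, t)) = fun t => Θ (z.1, t) / partialRho H (z.1, t) :=
      funext fun t => hV _
    rw [partialRho, this]
    exact (T2.fun_div U2 hu).deriv
  have hR2 : partialRho R z = (1 * G z + z.2 * partialRho G z) * Θ z +
      z.2 * G z * partialRho Θ z := by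
    have h1 : (fun t => R (z.1, t)) =ᶠ[𝓝 z.2] fun t => t * G (z.1, t) * Θ (z.1, t) :=
      hpath.eventually hR
    exact (((hasDerivAt_id z.2).fun_mul G2).fun_mul T2 |>.congr_of_eventuallyEq h1).deriv
  have hcomm : partialPhi (partialRho H) z = -((1 * G z + z.2 * partialRho G z) * partialRho H z +
      z.2 * G z * partialRho (partialRho H) z) := by
    rw [partialPhi_partialRho_comm hH]
    have h1 : (fun t => partialPhi H (z.1, t)) =ᶠ[𝓝 z.2]
        fun t => -(t * G (z.1, t) * partialRho H (z.1, t)) := hpath.eventually hpde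
    exact (((hasDerivAt_id z.2).fun_mul G2).fun_mul U2 |>.fun_neg.congr_of_eventuallyEq h1).deriv
  rw [hV1, hV2, hR2, hV z, hcomm, hR.self_of_nhds]
  field_simp
  ring

/-! ### Periodic functions on the cylinder -/

section Periodic

variable {F : ℝ × ℝ → ℝ}

lemma partialPhi_shift {c : ℝ} (hF : ∀ z : ℝ × ℝ, F (z.1 + c, z.2) = F z) (z : ℝ × ℝ) :
    partialPhi F (z.1 + c, z.2) = partialPhi F z := by
  have h : (fun s => F (s + c, z.2)) = fun s => F (s, z.2) := funext fun s => hF (s, z.2)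
  have h1 := deriv_comp_add_const (fun s => F (s, z.2)) c z.1
  rw [h] at h1
  exact h1.symm

lemma partialRho_shift {c : ℝ} (hF : ∀ z : ℝ × ℝ, F (z.1 + c, z.2) = F z) (z : ℝ × ℝ) :
    partialRho F (z.1 + c, z.2) = partialRho F z := by
  have h : (fun t => F (z.1 + c, t)) = fun t => F (z.1, t) := funext fun t => hF (z.1, t)
  rw [partialRho, partialRho, ← h]

lemma rhoCoeff_shift {c : ℝ} (hF : ∀ z : ℝ × ℝ, F (z.1 + c, z.2) = F z) (j : ℕ) (φ : ℝ) :
    rhoCoeff F j (φ + c) = rhoCoeff F j φ := by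
  have h : (fun t => F (φ + c, t)) = fun t => F (φ, t) := funext fun t => hF (φ, t)
  rw [rhoCoeff, rhoCoeff, h]

lemma divPow_shift {c : ℝ} (hF : ∀ z : ℝ × ℝ, F (z.1 + c, z.2) = F z) (k : ℕ) (z : ℝ × ℝ) :
    divPow F k (z.1 + c, z.2) = divPow F k z := by
  simp only [divPow, rhoCoeff_shift hF, hF z]

lemma exists_forall_of_eventually_nhds_of_periodic {p : ℝ × ℝ → Prop}
    (h : ∀ φ, ∀ᶠ z in 𝓝 (φ, (0 : ℝ)), p z)
    (hper : ∀ (n : ℤ) (z : ℝ × ℝ), p (z.1 + n * (2 * π), z.2) → p z) :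
    ∃ δ > 0, ∀ z : ℝ × ℝ, |z.2| ≤ δ → p z := by
  obtain ⟨δ, hδ, hall⟩ := exists_forall_of_eventually_nhds (α := 0) (β := 2 * π) h
  refine ⟨δ, hδ, fun z hz => ?_⟩
  obtain ⟨n, hn, -⟩ := existsUnique_add_zsmul_mem_Ico two_pi_pos z.1 0
  rw [zero_add, zsmul_eq_mul] at hn
  exact hper n z (hall _ (Ico_subset_Icc_self hn) hz)

lemma shift_int_mul (hF : ∀ z : ℝ × ℝ, F (z.1 + 2 * π, z.2) = F z) (n : ℤ) (z : ℝ × ℝ) :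
    F (z.1 + n * (2 * π), z.2) = F z := by
  have h : Function.Periodic (fun s => F (s, z.2)) (2 * π) := fun s => hF (s, z.2)
  exact h.int_mul n z.1

end Periodic

/-! ### The polar vector field -/

section Polar

variable {P Q : ℝ × ℝ → ℝ} {p q : ℕ}

lemma angularNumerator_add_two_pi (z : ℝ × ℝ) :
    angularNumerator P Q p q (z.1 + 2 * π, z.2) = angularNumerator P Q p q z := by
  simp [angularNumerator, weightedPolar]

lemma radialNumerator_add_two_pi (z : ℝ × ℝ) :
    radialNumerator P Q p q (z.1 + 2 * π, z.2) = radialNumerator P Q p q z := by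
  simp [radialNumerator, weightedPolar]

lemma jacobianFactor_pos (hp : 0 < p) (hq : 0 < q) (φ : ℝ) : 0 < jacobianFactor p q φ := by
  have hp' : (1 : ℝ) ≤ p := by exact_mod_cast hp
  have hq' : (1 : ℝ) ≤ q := by exact_mod_cast hq
  rw [jacobianFactor]
  nlinarith [sin_sq_add_cos_sq φ, sq_nonneg (cos φ), sq_nonneg (sin φ)]

lemma analyticAt_cos_fst (z : ℝ × ℝ) : AnalyticAt ℝ (fun z : ℝ × ℝ => cos z.1) z :=
  analyticAt_cos.comp_of_eq analyticAt_fst rfl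

lemma analyticAt_sin_fst (z : ℝ × ℝ) : AnalyticAt ℝ (fun z : ℝ × ℝ => sin z.1) z :=
  analyticAt_sin.comp_of_eq analyticAt_fst rfl

lemma analyticAt_weightedPolar (z : ℝ × ℝ) : AnalyticAt ℝ (weightedPolar p q) z :=
  ((analyticAt_snd.pow p).mul (analyticAt_cos_fst z)).prod
    ((analyticAt_snd.pow q).mul (analyticAt_sin_fst z))

lemma weightedPolar_zero (hp : 0 < p) (hq : 0 < q) (φ : ℝ) : weightedPolar p q (φ, 0) = (0, 0) := by
  simp [weightedPolar, hp.ne', hq.ne']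

lemma analyticAt_numerators (hp : 0 < p) (hq : 0 < q) (hP : AnalyticAt ℝ P (0, 0))
    (hQ : AnalyticAt ℝ Q (0, 0)) (φ : ℝ) :
    AnalyticAt ℝ (angularNumerator P Q p q) (φ, 0) ∧
      AnalyticAt ℝ (radialNumerator P Q p q) (φ, 0) := by
  have hw := analyticAt_weightedPolar (p := p) (q := q) (φ, 0)
  have hP' := hP.comp_of_eq hw (weightedPolar_zero hp hq φ)
  have hQ' := hQ.comp_of_eq hw (weightedPolar_zero hp hq φ)
  have hc := analyticAt_cos_fst (φ, 0)
  have hs := analyticAt_sin_fst (φ, 0)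
  have hr : AnalyticAt ℝ (fun z : ℝ × ℝ => z.2) (φ, 0) := analyticAt_snd
  exact ⟨((analyticAt_const.mul hc).mul ((hr.pow p).mul hQ')).sub
    ((analyticAt_const.mul hs).mul ((hr.pow q).mul hP')),
    (hc.mul ((hr.pow q).mul hP')).add (hs.mul ((hr.pow p).mul hQ'))⟩

lemma rhoCoeff_numerators_eq_zero {i : ℕ} (hi : i < commonOrder P Q p q) (φ : ℝ) :
    rhoCoeff (angularNumerator P Q p q) i φ = 0 ∧ rhoCoeff (radialNumerator P Q p q) i φ = 0 := by
  have h := Nat.notMem_of_lt_sInf hi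
  simp only [mem_ofPred_eq, not_exists, not_or, not_not] at h
  simp [rhoCoeff, h φ]

lemma polarTheta_eq (z : ℝ × ℝ) : polarTheta P Q p q z =
    divPow (angularNumerator P Q p q) (commonOrder P Q p q) z / jacobianFactor p q z.1 := by
  rw [polarTheta, divPow]
  split_ifs
  · rw [rhoCoeff, div_div]
  · rw [div_div]

lemma polarR_eq (z : ℝ × ℝ) : polarR P Q p q z =
    z.2 * divPow (radialNumerator P Q p q) (commonOrder P Q p q) z / jacobianFactor p q z.1 := by
  rw [polarR, divPow]
  split_ifs with h
  · simp [h]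
  · rw [mul_div_assoc', div_div]

end Polar

/-! ### The inverse integrating factor of a center -/

theorem mainTheorem4 (D : Set (ℝ × ℝ)) (hD : IsOpen D) (h0 : (0, 0) ∈ D)
    (P Q : ℝ × ℝ → ℝ) (hP : AnalyticOnNhd ℝ P D) (hQ : AnalyticOnNhd ℝ Q D)
    (hcenter : IsCenter D P Q)
    (p q : ℕ) (hp : 0 < p) (hq : 0 < q) (hpq : Nat.Coprime p q)
    (hchar : characteristicDirections P Q p q = ∅) :
    ∃ δ : ℝ, 0 < δ ∧ ∃ V : ℝ × ℝ → ℝ,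
      IsInverseIntegratingFactor (polarTheta P Q p q) (polarR P Q p q) δ V ∧
      AnalyticOnNhd ℝ V (cylinder δ) ∧
      ∃ m : ℤ, 0 ≤ m ∧ ∃ v : ℤ → ℝ → ℝ, HasAscendingExpansion V δ m v := by
  set k := commonOrder P Q p q
  set A := divPow (angularNumerator P Q p q) k with hAdef
  set B := divPow (radialNumerator P Q p q) k with hBdef
  set Θ := polarTheta P Q p q
  set R := polarR P Q p q
  have hJ := jacobianFactor_pos hp hq
  have hΘeq : ∀ z, Θ z = A z / jacobianFactor p q z.1 := polarTheta_eq
  have hReq : ∀ z, R z = z.2 * B z / jacobianFactor p q z.1 := polarR_eq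
  have hA : ∀ φ, AnalyticAt ℝ A (φ, 0) := fun φ =>
    analyticAt_divPow (analyticAt_numerators hp hq (hP _ h0) (hQ _ h0) φ).1
      fun i hi φ => (rhoCoeff_numerators_eq_zero hi φ).1
  have hB : ∀ φ, AnalyticAt ℝ B (φ, 0) := fun φ =>
    analyticAt_divPow (analyticAt_numerators hp hq (hP _ h0) (hQ _ h0) φ).2
      fun i hi φ => (rhoCoeff_numerators_eq_zero hi φ).2
  have hA0 : ∀ φ, A (φ, 0) ≠ 0 := by
    intro φ h
    have : φ ∈ characteristicDirections P Q p q := by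
      change Θ (φ, 0) = 0
      rw [hΘeq, h, zero_div]
    rw [hchar] at this
    exact this
  have hAne : ∀ φ, ∀ᶠ z in 𝓝 (φ, (0 : ℝ)), A z ≠ 0 := fun φ =>
    (hA φ).continuousAt.eventually_ne (hA0 φ)
  have hΘ : ∀ φ, AnalyticAt ℝ Θ (φ, 0) := fun φ => by
    have hj : AnalyticAt ℝ (fun z : ℝ × ℝ => jacobianFactor p q z.1) (φ, 0) :=
      (analyticAt_const.mul ((analyticAt_cos_fst _).pow 2)).add
        (analyticAt_const.mul ((analyticAt_sin_fst _).pow 2))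
    rw [show Θ = fun z => A z / jacobianFactor p q z.1 from funext hΘeq]
    exact (hA φ).div hj (hJ φ).ne'
  set G : ℝ × ℝ → ℝ := fun z => B z / A z with hGdef
  have hG : ∀ φ, AnalyticAt ℝ G (φ, 0) := fun φ => (hB φ).div (hA φ) (hA0 φ)
  have hRG : ∀ z, A z ≠ 0 → R z = z.2 * G z * Θ z := fun z hz => by
    rw [hReq, hΘeq, hGdef]
    field_simp
  have hAper : ∀ z : ℝ × ℝ, A (z.1 + 2 * π, z.2) = A z := divPow_shift angularNumerator_add_two_pi k
  have hBper : ∀ z : ℝ × ℝ, B (z.1 + 2 * π, z.2) = B z := divPow_shift radialNumerator_add_two_pi k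
  have hJper : ∀ φ, jacobianFactor p q (φ + 2 * π) = jacobianFactor p q φ := fun φ => by
    simp [jacobianFactor]
  have hGper : ∀ z : ℝ × ℝ, G (z.1 + 2 * π, z.2) = G z := fun z => by
    simp only [hGdef, hAper z, hBper z]
  have hΘper : ∀ z : ℝ × ℝ, Θ (z.1 + 2 * π, z.2) = Θ z := fun z => by
    rw [hΘeq, hΘeq, hAper z, hJper z.1]
  have hRper : ∀ z : ℝ × ℝ, R (z.1 + 2 * π, z.2) = R z := fun z => by
    rw [hReq, hReq, hBper z, hJper z.1]
  have hwD : ∀ φ, ∀ᶠ z in 𝓝 (φ, (0 : ℝ)), weightedPolar p q z ∈ D := fun φ =>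
    (analyticAt_weightedPolar (φ, 0)).continuousAt.eventually_mem
      (hD.mem_nhds (by rw [weightedPolar_zero hp hq]; exact h0))
  have hAG : ∀ φ, ∀ᶠ z in 𝓝 (φ, (0 : ℝ)), 0 < z.2 → angularNumerator P Q p q z ≠ 0 ∧
      G z = radialNumerator P Q p q z / angularNumerator P Q p q z := fun φ => by
    filter_upwards [hAne φ] with z hz hz2
    have e1 : A z = angularNumerator P Q p q z / z.2 ^ k := by rw [hAdef, divPow, if_neg hz2.ne']
    have e2 : B z = radialNumerator P Q p q z / z.2 ^ k := by rw [hBdef, divPow, if_neg hz2.ne']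
    rw [e1] at hz
    refine ⟨fun h => hz (by rw [h, zero_div]), ?_⟩
    rw [hGdef]
    simp only [e1, e2]
    exact div_div_div_cancel_right₀ (pow_pos hz2 k).ne' _ _
  have hfix : ∃ᶠ ρ in 𝓝[≠] 0, firstIntegral G (2 * π, ρ) = ρ := by
    have h1 : ∃ᶠ ρ in 𝓝[>] 0, firstIntegral G (2 * π, ρ) = ρ := by
      rw [(nhdsGT_basis (0 : ℝ)).frequently_iff]
      exact fun ε hε => exists_firstIntegral_two_pi_eq hP hQ hcenter hp hq hG hwD hAG hε
    exact h1.filter_mono (nhdsWithin_mono _ fun x hx => ne_of_gt hx)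
  set H := firstIntegral G
  have hHper : ∀ z : ℝ × ℝ, H (z.1 + 2 * π, z.2) = H z := periodic_firstIntegral hG hGper hfix
  have hH := analyticAt_firstIntegral hG
  have hu0 : ∀ φ, partialRho H (φ, 0) ≠ 0 := fun φ => by
    rw [partialRho, (hasDerivAt_firstIntegral_zero hG φ).deriv]
    exact (integratingFactor_pos φ).ne'
  have hpde : ∀ φ, ∀ᶠ z in 𝓝 (φ, (0 : ℝ)), partialPhi H z = -(z.2 * G z * partialRho H z) := by
    intro φ
    filter_upwards [eventually_hasDerivAt_firstIntegral hG φ] with z ⟨d, h1, h2⟩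
    rw [partialPhi, partialRho, h1.deriv, h2.deriv]
  set V : ℝ × ℝ → ℝ := fun z => Θ z / partialRho H z with hVdef
  have hV : ∀ φ, AnalyticAt ℝ V (φ, 0) := fun φ =>
    (hΘ φ).div (analyticAt_partialRho (hH φ)) (hu0 φ)
  have hVper : ∀ z : ℝ × ℝ, V (z.1 + 2 * π, z.2) = V z := fun z => by
    simp only [hVdef, hΘper z, partialRho_shift hHper]
  have heq : ∀ φ, ∀ᶠ z in 𝓝 (φ, (0 : ℝ)),
      Θ z * partialPhi V z + R z * partialRho V z = V z * (partialPhi Θ z + partialRho R z) := by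
    intro φ
    filter_upwards [(hH φ).eventually_analyticAt, (hG φ).eventually_analyticAt,
      (hΘ φ).eventually_analyticAt, (hAne φ).eventually_nhds, (hpde φ).eventually_nhds,
      (analyticAt_partialRho (hH φ)).continuousAt.eventually_ne (hu0 φ)] with z z1 z2 z3 z4 z5 z6
    exact equation_of_firstIntegral z1 z2 z3 (z4.mono hRG) (fun w => rfl) z5 z6
  obtain ⟨δ, hδ, hall⟩ := exists_forall_of_eventually_nhds_of_periodic (p := fun z =>
    AnalyticAt ℝ V z ∧
      Θ z * partialPhi V z + R z * partialRho V z = V z * (partialPhi Θ z + partialRho R z) ∧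
      HasSum (fun j => rhoCoeff V j z.1 * z.2 ^ j) (V z)) (fun φ =>
    (hV φ).eventually_analyticAt.and ((heq φ).and (eventually_hasSum_rhoCoeff (hV φ)))) (by
      rintro n z ⟨h1, h2, h3⟩
      have hs := shift_int_mul hVper n
      refine ⟨?_, ?_, ?_⟩
      · have hshift : AnalyticAt ℝ (fun w : ℝ × ℝ => (w.1 + n * (2 * π), w.2)) z :=
          (analyticAt_fst.add analyticAt_const).prod analyticAt_snd
        exact (h1.comp_of_eq hshift rfl).congr (Eventually.of_forall hs)
      · rwa [hs, shift_int_mul hΘper, shift_int_mul hRper, partialPhi_shift hs,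
          partialRho_shift hs, partialPhi_shift (shift_int_mul hΘper n),
          partialRho_shift (shift_int_mul hRper n)] at h2
      · simpa only [hs, rhoCoeff_shift hs] using h3)
  have hcyl : ∀ z ∈ cylinder δ, |z.2| ≤ δ := fun z hz => by
    rw [abs_of_nonneg hz.1]; exact hz.2.le
  have hpunct : puncturedCylinder δ ⊆ cylinder δ := fun z hz => ⟨hz.1.le, hz.2⟩
  have hvper : ∀ j, Function.Periodic (rhoCoeff V j) (2 * π) := fun j => rhoCoeff_shift hVper j
  refine ⟨δ, hδ, V, ⟨fun z _ => hVper z, ?_, fun z hz => (hall z (hcyl z (hpunct hz))).2.1⟩,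
    fun z hz => (hall z (hcyl z hz)).1, 0, le_rfl, fun j => rhoCoeff V j.toNat,
    fun j _ => hvper j.toNat, fun j _ => ?_, ⟨0, ?_⟩, fun z hz => ?_⟩
  · exact fun z hz => (hall z (hcyl z (hpunct hz))).1.contDiffAt.contDiffWithinAt
  · obtain ⟨M, hM⟩ := ((hvper j.toNat).compact_of_continuous two_pi_pos.ne'
      (continuous_rhoCoeff hV j.toNat)).isBounded.exists_norm_le
    exact ⟨M, fun φ => hM _ ⟨φ, rfl⟩⟩
  · have : rhoCoeff V 0 0 = Θ (0, 0) / partialRho H (0, 0) := by simp [rhoCoeff, hVdef]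
    rw [Int.toNat_zero, this, hΘeq]
    exact div_ne_zero (div_ne_zero (hA0 0) (hJ _).ne') (hu0 0)
  · simpa using (hall z (hcyl z (hpunct hz))).2.2
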